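/- Let $\mathbb K$ be a field of characteristic $0$. A framed chord diagram is a finite collection of chords (pairs of pairwise distinct points on an oriented circle, up to orientation preserving diffeomorphisms of the circle), each chord having a framing in $\mathbb Z/2\mathbb Z$; chords of framing $0$ are called oriented, chords of framing $1$ disorienting. A diagram is black if all its chords are oriented and white if all its chords are disorienting. Black diagrams are identified with chord diagrams without framing. For two distinct chords $a,b$ of a diagram, cut the circle so that the endpoints read $b\,P\,b\,Q$, where one endpoint of $a$ lies in $P$ or $Q$ and the other one is the jumping endpoint. The framed 4T-relations are: if $b$ is oriented, $$[a\,b\,P\,b\,Q]-[b\,a\,P\,b\,Q]=[b\,P\,b\,a\,Q]-[b\,P\,a\,b\,Q],$$ with all framings the same in the four diagrams; if $b$ is disorienting, $$[a\,b\,P\,b\,Q]-[b\,a\,P\,b\,Q]=[b\,P\,a'\,b\,Q]-[b\,P\,b\,a'\,Q],$$ where $a'$ means that in the two diagrams on the right the framing of the chord $a$ is changed. Let $\mathcal M$ be the $\mathbb K$-vector space spanned by framed chord diagrams modulo the framed 4T-relations, and $\mathcal A$ the space spanned by chord diagrams modulo the relations of the first kind. Cutting and glueing circles defines a product $\mathcal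 A\otimes\mathcal M\to\mathcal M$. Let $1\in\mathcal A$ be the empty diagram, let $\Delta(d)=\sum_{I\sqcup J}d_I\otimes d_J$ be the coproduct $\mathcal M\to\mathcal M\otimes\mathcal M$ (the sum over all decompositions of the set of chords of $d$ into two disjoint subsets, $d_I$ being the subdiagram formed by the chords of $I$), let $\mathrm{Pr}\colon\mathcal M\to\mathcal A$ be the identity on black diagrams and $0$ on all other diagrams, and put $\delta=(\mathrm{Pr}\otimes\mathrm{id})\circ\Delta\colon\mathcal M\to\mathcal A\otimes\mathcal M$. Let $Co_{\mathcal M}=\{v\in\mathcal M:\delta(v)=1\otimes v\}$ be the covariant subspace. 1. The space $Co_{\mathcal M}$ is the span of the classes of the white diagrams. 2. In $\mathcal M$, every framed chord diagram is a linear combination of products $c\cdot w$ of a black diagram $c$ by a white diagram $w$. 3. Consequently, every linear functional $s\colon\mathcal M\to\mathbb K$ that is homogeneous of degree $n$ (it vanishes on diagrams whose number of chords is not $n$) is a finite linear combination of products $\varphi\cdot\psi$ of a linear functional $\varphi$ on $\mathcal A$, homogeneous of degree $k$, by a linear functional $\psi$ on $Co_{\mathcal M}$, homogeneous of degree $l$,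 with $k+l=n$; here $\varphi\cdot\psi$ is the functional on $\mathcal M$ with $(\varphi\cdot\psi)(cv)=\varphi(c)\psi(v)$ for all $c\in\mathcal A$, $v\in Co_{\mathcal M}$. -/

import Mathlib

open scoped TensorProduct

/-! ### Chord diagrams and framed chord diagrams -/

/-- Every letter of the word occurs exactly twice. -/
def IsDouble (l : List ℕ) : Prop := ∀ x ∈ l, l.count x = 2

/-- A chord diagram cut open at a point of the oriented circle that is not an endpoint of a chord.
The chords are named by natural numbers, and `letters` lists the chords in the order in which their
endpoints are met when the circle is travelled along its orientation. -/
structure ChordWord where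
  letters : List ℕ
  double : IsDouble letters

/-- A chord diagram with a framing, cut open at a point. Only the framings of the chords of the
diagram matter: see `FramedWord.Iso`. -/
structure FramedWord extends ChordWord where
  framing : ℕ → ZMod 2

/-- Two cut diagrams represent the same chord diagram: one is obtained from the other by changing
the cut point (a rotation of the word) and the names of the chords. -/
def ChordWord.Iso (c d : ChordWord) : Prop :=
  ∃ σ : Equiv.Perm ℕ, c.letters.map σ ~r d.letters

/-- Two cut framed diagrams represent the same framed chord diagram. -/
def FramedWord.Iso (c d : FramedWord) : Prop :=
  ∃ σ : Equiv.Perm ℕ, c.letters.map σ ~r d.letters ∧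
    ∀ x ∈ c.letters, d.framing (σ x) = c.framing x

instance ChordWord.setoid : Setoid ChordWord where
  r := ChordWord.Iso
  iseqv := by
    refine ⟨fun c => ⟨1, by simpa using List.IsRotated.refl _⟩, ?_, ?_⟩
    · rintro c d ⟨σ, h⟩
      exact ⟨σ.symm, by simpa using (h.map σ.symm).symm⟩
    · rintro c d e ⟨σ, h⟩ ⟨τ, h'⟩
      refine ⟨σ.trans τ, ?_⟩
      have := (h.map τ).trans h'
      simpa using this

instance FramedWord.setoid : Setoid FramedWord where
  r := FramedWord.Iso
  iseqv := by
    refine ⟨fun c => ⟨1, by simpa using List.IsRotated.refl _, by simp⟩, ?_, ?_⟩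
    · rintro c d ⟨σ, h, hf⟩
      refine ⟨σ.symm, by simpa using (h.map σ.symm).symm, fun x hx => ?_⟩
      obtain ⟨y, hy, rfl⟩ := List.mem_map.1 (h.mem_iff.2 hx)
      simpa using (hf y hy).symm
    · rintro c d e ⟨σ, h, hf⟩ ⟨τ, h', hf'⟩
      refine ⟨σ.trans τ, ?_, fun x hx => ?_⟩
      · have := (h.map τ).trans h'
        simpa using this
      · have hx' : σ x ∈ d.letters := h.mem_iff.1 (List.mem_map_of_mem hx)
        simpa [hf x hx] using hf' _ hx'

/-- Chord diagrams. -/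
def ChordDiagram : Type := Quotient ChordWord.setoid

/-- Framed chord diagrams. -/
def FramedChordDiagram : Type := Quotient FramedWord.setoid

/-- The chord diagram represented by a cut diagram. -/
def ChordWord.diagram (c : ChordWord) : ChordDiagram := Quotient.mk _ c

/-- The framed chord diagram represented by a cut framed diagram. -/
def FramedWord.diagram (d : FramedWord) : FramedChordDiagram := Quotient.mk _ d

/-- The set of chords of a cut diagram. -/
def ChordWord.chords (c : ChordWord) : Finset ℕ := c.letters.toFinset

theorem FramedWord.Iso.chords {c d : FramedWord} {σ : Equiv.Perm ℕ}
    (h : c.letters.map σ ~r d.letters) : d.chords = c.chords.map σ.toEmbedding := by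
  ext x
  simp only [ChordWord.chords, List.mem_toFinset, ← h.mem_iff, List.mem_map, Finset.mem_map]
  rfl

/-- The number of chords of a chord diagram. -/
def ChordDiagram.order : ChordDiagram → ℕ :=
  Quotient.lift (fun c : ChordWord => c.chords.card) (by
    rintro c d ⟨σ, h⟩
    have : d.chords = c.chords.map σ.toEmbedding := by
      ext x
      simp only [ChordWord.chords, List.mem_toFinset, ← h.mem_iff, List.mem_map, Finset.mem_map]
      rfl
    simp [this])

/-- The number of chords of a framed chord diagram. -/
def FramedChordDiagram.order : FramedChordDiagram → ℕ :=
  Quotient.lift (fun d : FramedWord => d.chords.card) (by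
    rintro c d ⟨σ, h, -⟩
    simp [FramedWord.Iso.chords h])

theorem FramedWord.Iso.framing_eq {c d : FramedWord} (h : c ≈ d) (t : ZMod 2) :
    (∀ x ∈ c.letters, c.framing x = t) ↔ ∀ x ∈ d.letters, d.framing x = t := by
  obtain ⟨σ, h, hf⟩ := h
  constructor
  · intro H x hx
    obtain ⟨y, hy, rfl⟩ := List.mem_map.1 (h.mem_iff.2 hx)
    rw [hf y hy, H y hy]
  · intro H x hx
    rw [← hf x hx]
    exact H _ (h.mem_iff.1 (List.mem_map_of_mem hx))

/-- A framed chord diagram is white if all its chords are disorienting (have framing `1`). -/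
def FramedChordDiagram.IsWhite : FramedChordDiagram → Prop :=
  Quotient.lift (fun d : FramedWord => ∀ x ∈ d.letters, d.framing x = 1)
    (fun _ _ h => propext (FramedWord.Iso.framing_eq h 1))

/-! ### The spaces `𝒜` and `ℳ` -/

section Spaces

variable (K : Type*) [Field K]

/-- The 4T-elements of the space spanned by chord diagrams. The shared chord is `b`, the jumping
chord is `a`; the other endpoint of `a` and all other chords lie in `P` and `Q`. -/
def fourTerm : Set (ChordDiagram →₀ K) :=
  {v | ∃ (a b : ℕ) (P Q : List ℕ) (w₁ w₂ w₃ w₄ : ChordWord),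
    w₁.letters = a :: b :: (P ++ b :: Q) ∧ w₂.letters = b :: a :: (P ++ b :: Q) ∧
    w₃.letters = b :: (P ++ a :: b :: Q) ∧ w₄.letters = b :: (P ++ b :: a :: Q) ∧
    v = (Finsupp.single w₁.diagram 1 - Finsupp.single w₂.diagram 1)
      - (Finsupp.single w₄.diagram 1 - Finsupp.single w₃.diagram 1)}

/-- The framed 4T-elements. If the shared chord `b` is oriented, the framing `f` is the same in all
four diagrams; if `b` is disorienting, the framing of the jumping chord `a` changes when `a` jumps
from one end of `b` to the other, and the two diagrams at the other end are interchanged. -/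
def framedFourTerm : Set (FramedChordDiagram →₀ K) :=
  {v | ∃ (a b : ℕ) (P Q : List ℕ) (f : ℕ → ZMod 2) (w₁ w₂ w₃ w₄ : FramedWord),
    w₁.letters = a :: b :: (P ++ b :: Q) ∧ w₂.letters = b :: a :: (P ++ b :: Q) ∧
    w₃.letters = b :: (P ++ a :: b :: Q) ∧ w₄.letters = b :: (P ++ b :: a :: Q) ∧
    w₁.framing = f ∧ w₂.framing = f ∧
    ((f b = 0 ∧ w₃.framing = f ∧ w₄.framing = f ∧
        v = (Finsupp.single w₁.diagram 1 - Finsupp.single w₂.diagram 1)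
          - (Finsupp.single w₄.diagram 1 - Finsupp.single w₃.diagram 1)) ∨
      (f b = 1 ∧ w₃.framing = Function.update f a (f a + 1) ∧
        w₄.framing = Function.update f a (f a + 1) ∧
        v = (Finsupp.single w₁.diagram 1 - Finsupp.single w₂.diagram 1)
          - (Finsupp.single w₃.diagram 1 - Finsupp.single w₄.diagram 1)))}

/-- The space `𝒜` of chord diagrams modulo 4T-relations. -/
abbrev SpaceA : Type _ := (ChordDiagram →₀ K) ⧸ Submodule.span K (fourTerm K)

/-- The space `ℳ` of framed chord diagrams modulo framed 4T-relations. -/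
abbrev SpaceM : Type _ := (FramedChordDiagram →₀ K) ⧸ Submodule.span K (framedFourTerm K)

/-- The class of a chord diagram in `𝒜`. -/
noncomputable def ChordDiagram.toA (c : ChordDiagram) : SpaceA K :=
  Submodule.Quotient.mk (Finsupp.single c 1)

/-- The class of a framed chord diagram in `ℳ`. -/
noncomputable def FramedChordDiagram.toM (d : FramedChordDiagram) : SpaceM K :=
  Submodule.Quotient.mk (Finsupp.single d 1)

/-- The unit of `𝒜`: the class of the diagram without chords. -/
noncomputable def oneA : SpaceA K := (ChordWord.diagram ⟨[], by simp [IsDouble]⟩).toA K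

/-- A function on framed chord diagrams that respects the 4T-relations extends linearly to `ℳ`. -/
noncomputable def extendM {V : Type*} [AddCommGroup V] [Module K V] (g : FramedChordDiagram → V)
    (h : framedFourTerm K ⊆ LinearMap.ker (Finsupp.linearCombination K g)) : SpaceM K →ₗ[K] V :=
  Submodule.liftQ _ (Finsupp.linearCombination K g) (Submodule.span_le.2 h)

/-- A function on chord diagrams that respects the 4T-relations extends linearly to `𝒜`. -/
noncomputable def extendA {V : Type*} [AddCommGroup V] [Module K V] (g : ChordDiagram → V)
    (h : fourTerm K ⊆ LinearMap.ker (Finsupp.linearCombination K g)) : SpaceA K →ₗ[K] V :=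
  Submodule.liftQ _ (Finsupp.linearCombination K g) (Submodule.span_le.2 h)

theorem extendM_toM {V : Type*} [AddCommGroup V] [Module K V] (g : FramedChordDiagram → V)
    (h : framedFourTerm K ⊆ LinearMap.ker (Finsupp.linearCombination K g))
    (d : FramedChordDiagram) : extendM K g h (d.toM K) = g d := by
  rw [extendM, FramedChordDiagram.toM, Submodule.liftQ_apply, Finsupp.linearCombination_single,
    one_smul]

theorem extendA_toA {V : Type*} [AddCommGroup V] [Module K V] (g : ChordDiagram → V)
    (h : fourTerm K ⊆ LinearMap.ker (Finsupp.linearCombination K g))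
    (d : ChordDiagram) : extendA K g h (d.toA K) = g d := by
  rw [extendA, ChordDiagram.toA, Submodule.liftQ_apply, Finsupp.linearCombination_single,
    one_smul]

/-! ### The projection `ℳ → 𝒜` -/

open Classical in
/-- The projection on diagrams: black diagrams (all chords oriented, that is, of framing `0`) lose
their framing, all other diagrams go to `0`. -/
noncomputable def prDiagram : FramedChordDiagram → SpaceA K :=
  Quotient.lift (fun d : FramedWord =>
      if ∀ x ∈ d.letters, d.framing x = 0 then d.toChordWord.diagram.toA K else 0) (by
    intro c d h
    have h0 := FramedWord.Iso.framing_eq h 0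
    obtain ⟨σ, h, hf⟩ := h
    have : c.toChordWord.diagram = d.toChordWord.diagram := Quotient.sound ⟨σ, h⟩
    simp only [this]
    split_ifs <;> tauto)

theorem prDiagram_black (d : FramedWord) (h : ∀ x ∈ d.letters, d.framing x = 0) :
    prDiagram K d.diagram = d.toChordWord.diagram.toA K := if_pos h

theorem prDiagram_of_not_black (d : FramedWord) (h : ¬ ∀ x ∈ d.letters, d.framing x = 0) :
    prDiagram K d.diagram = 0 := if_neg h

theorem prDiagram_fourTerm :
    framedFourTerm K ⊆ LinearMap.ker (Finsupp.linearCombination K (prDiagram K)) := by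
  rintro v ⟨a, b, P, Q, f, w₁, w₂, w₃, w₄, h₁, h₂, h₃, h₄, f₁, f₂, H⟩
  rcases H with ⟨hb, f₃, f₄, rfl⟩ | ⟨hb, f₃, f₄, rfl⟩
  · have m₂ : (∀ x ∈ w₂.letters, w₂.framing x = 0) ↔ ∀ x ∈ w₁.letters, w₁.framing x = 0 := by
      rw [h₁, h₂, f₁, f₂]; simp; tauto
    have m₃ : (∀ x ∈ w₃.letters, w₃.framing x = 0) ↔ ∀ x ∈ w₁.letters, w₁.framing x = 0 := by
      rw [h₁, h₃, f₁, f₃]; simp; grind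
    have m₄ : (∀ x ∈ w₄.letters, w₄.framing x = 0) ↔ ∀ x ∈ w₁.letters, w₁.framing x = 0 := by
      rw [h₁, h₄, f₁, f₄]; simp; grind
    by_cases B : ∀ x ∈ w₁.letters, w₁.framing x = 0
    · simp only [SetLike.mem_coe, LinearMap.mem_ker, map_sub, Finsupp.linearCombination_single,
        one_smul]
      rw [prDiagram_black K _ B, prDiagram_black K _ (m₂.2 B), prDiagram_black K _ (m₃.2 B),
        prDiagram_black K _ (m₄.2 B)]
      simp only [ChordDiagram.toA, ← Submodule.Quotient.mk_sub]
      rw [Submodule.Quotient.mk_eq_zero]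
      exact Submodule.subset_span ⟨a, b, P, Q, _, _, _, _, h₁, h₂, h₃, h₄, rfl⟩
    · simp [prDiagram_of_not_black K _ B, prDiagram_of_not_black K _ (mt m₂.1 B),
        prDiagram_of_not_black K _ (mt m₃.1 B), prDiagram_of_not_black K _ (mt m₄.1 B)]
  · have hab : a ≠ b := by
      rintro rfl
      have := w₁.double a (by simp [h₁])
      simp [h₁] at this
    have key : ∀ w : FramedWord, b ∈ w.letters → w.framing b = 1 → prDiagram K w.diagram = 0 := by
      intro w hw h1
      refine prDiagram_of_not_black K w fun h => ?_
      rw [h b hw] at h1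
      exact absurd h1 (by decide)
    have hba := hab.symm
    simp [key w₁ (by simp [h₁]) (by simp [f₁, hb]), key w₂ (by simp [h₂]) (by simp [f₂, hb]),
      key w₃ (by simp [h₃]) (by simp [f₃, hb, hba]),
      key w₄ (by simp [h₄]) (by simp [f₄, hb, hba])]

/-- The projection `ℳ → 𝒜`. -/
noncomputable def prM : SpaceM K →ₗ[K] SpaceA K := extendM K (prDiagram K) (prDiagram_fourTerm K)

/-! ### The coproduct of `ℳ` and the coaction of `𝒜` -/

/-- The subdiagram formed by the chords that belong to `I`. -/
def FramedWord.sub (d : FramedWord) (I : Finset ℕ) : FramedWord where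
  letters := d.letters.filter (· ∈ I)
  double := by
    intro x hx
    rw [List.mem_filter] at hx
    exact (List.count_filter (p := fun y => decide (y ∈ I)) hx.2).trans (d.double x hx.1)
  framing := d.framing

theorem List.IsRotated.filter' {α : Type*} {l l' : List α} (h : l ~r l') (p : α → Bool) :
    l.filter p ~r l'.filter p := by
  obtain ⟨n, hn, rfl⟩ := List.isRotated_iff_mod.1 h
  rw [List.rotate_eq_drop_append_take hn, List.filter_append]
  conv_lhs => rw [← List.take_append_drop n l, List.filter_append]
  exact List.isRotated_append

theorem FramedWord.sub_iso {c d : FramedWord} {σ : Equiv.Perm ℕ}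
    (h : c.letters.map σ ~r d.letters) (hf : ∀ x ∈ c.letters, d.framing (σ x) = c.framing x)
    (I : Finset ℕ) : (c.sub I).diagram = (d.sub (I.map σ.toEmbedding)).diagram := by
  refine Quotient.sound ⟨σ, ?_, fun x hx => hf x (List.mem_filter.1 hx).1⟩
  have := h.filter' (fun x => decide (x ∈ I.map σ.toEmbedding))
  rw [List.filter_map] at this
  refine Eq.mp ?_ this
  congr 2
  refine List.filter_congr fun x _ => ?_
  simp

theorem FramedWord.diagram_eq {c d : FramedWord} (h : c.letters = d.letters)
    (hf : ∀ x ∈ c.letters, d.framing x = c.framing x) : c.diagram = d.diagram :=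
  Quotient.sound ⟨1, by simpa [h] using List.IsRotated.refl _, hf⟩

/-- The summand of the coproduct of a diagram that belongs to the decomposition of the set of
chords into `I` and its complement. -/
noncomputable def FramedWord.coterm (d : FramedWord) (I : Finset ℕ) : SpaceM K ⊗[K] SpaceM K :=
  (d.sub I).diagram.toM K ⊗ₜ[K] (d.sub (d.chords \ I)).diagram.toM K

/-- The coproduct of a diagram: the sum of `d_I ⊗ d_J` over all decompositions of the set of chords
into two disjoint subsets `I` and `J`. -/
noncomputable def coproductDiagram : FramedChordDiagram → SpaceM K ⊗[K] SpaceM K :=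
  Quotient.lift (fun d : FramedWord => ∑ I ∈ d.chords.powerset, d.coterm K I) (by
    rintro c d ⟨σ, h, hf⟩
    have hc := FramedWord.Iso.chords h
    refine Finset.sum_bij (fun I _ => I.map σ.toEmbedding) ?_ ?_ ?_ ?_
    · intro I hI
      rw [Finset.mem_powerset] at hI ⊢
      rw [hc]
      exact Finset.map_subset_map.2 hI
    · intro I _ J _ e
      exact Finset.map_injective _ e
    · intro J hJ
      rw [Finset.mem_powerset, hc, Finset.subset_map_iff] at hJ
      obtain ⟨I, hI, rfl⟩ := hJ
      exact ⟨I, Finset.mem_powerset.2 hI, rfl⟩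
    · intro I _
      rw [FramedWord.coterm, FramedWord.coterm, hc, ← Finset.map_sdiff,
        ← FramedWord.sub_iso h hf, ← FramedWord.sub_iso h hf])

theorem coproductDiagram_diagram (d : FramedWord) :
    coproductDiagram K d.diagram = ∑ I ∈ d.chords.powerset, d.coterm K I := rfl

theorem toM_fourTerm_oriented {a b : ℕ} {P Q : List ℕ} {w₁ w₂ w₃ w₄ : FramedWord}
    (h₁ : w₁.letters = a :: b :: (P ++ b :: Q)) (h₂ : w₂.letters = b :: a :: (P ++ b :: Q))
    (h₃ : w₃.letters = b :: (P ++ a :: b :: Q)) (h₄ : w₄.letters = b :: (P ++ b :: a :: Q))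
    (f₂ : w₂.framing = w₁.framing) (f₃ : w₃.framing = w₁.framing)
    (f₄ : w₄.framing = w₁.framing) (hb : w₁.framing b = 0) :
    (w₁.diagram.toM K - w₂.diagram.toM K) - (w₄.diagram.toM K - w₃.diagram.toM K) = 0 := by
  simp only [FramedChordDiagram.toM, ← Submodule.Quotient.mk_sub]
  rw [Submodule.Quotient.mk_eq_zero]
  exact Submodule.subset_span
    ⟨a, b, P, Q, _, w₁, w₂, w₃, w₄, h₁, h₂, h₃, h₄, rfl, f₂, Or.inl ⟨hb, f₃, f₄, rfl⟩⟩

theorem toM_fourTerm_disorienting {a b : ℕ} {P Q : List ℕ} {w₁ w₂ w₃ w₄ : FramedWord}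
    (h₁ : w₁.letters = a :: b :: (P ++ b :: Q)) (h₂ : w₂.letters = b :: a :: (P ++ b :: Q))
    (h₃ : w₃.letters = b :: (P ++ a :: b :: Q)) (h₄ : w₄.letters = b :: (P ++ b :: a :: Q))
    (f₂ : w₂.framing = w₁.framing)
    (f₃ : w₃.framing = Function.update w₁.framing a (w₁.framing a + 1))
    (f₄ : w₄.framing = Function.update w₁.framing a (w₁.framing a + 1))
    (hb : w₁.framing b = 1) :
    (w₁.diagram.toM K - w₂.diagram.toM K) - (w₃.diagram.toM K - w₄.diagram.toM K) = 0 := by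
  simp only [FramedChordDiagram.toM, ← Submodule.Quotient.mk_sub]
  rw [Submodule.Quotient.mk_eq_zero]
  exact Submodule.subset_span
    ⟨a, b, P, Q, _, w₁, w₂, w₃, w₄, h₁, h₂, h₃, h₄, rfl, f₂, Or.inr ⟨hb, f₃, f₄, rfl⟩⟩

theorem coproductDiagram_fourTerm :
    framedFourTerm K ⊆ LinearMap.ker (Finsupp.linearCombination K (coproductDiagram K)) := by
  rintro v ⟨a, b, P, Q, f, w₁, w₂, w₃, w₄, h₁, h₂, h₃, h₄, f₁, f₂, H⟩
  have c₂ : w₂.chords = w₁.chords := by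
    ext x; simp [ChordWord.chords, h₁, h₂]
  have c₃ : w₃.chords = w₁.chords := by
    ext x; simp [ChordWord.chords, h₁, h₃]
  have c₄ : w₄.chords = w₁.chords := by
    ext x; simp [ChordWord.chords, h₁, h₄]; tauto
  have ha : a ∈ w₁.chords := by simp [ChordWord.chords, h₁]
  have hb : b ∈ w₁.chords := by simp [ChordWord.chords, h₁]
  -- chord sets that do not contain both `a` and `b` do not distinguish the diagrams of a pair
  have p₁₂ : ∀ I : Finset ℕ, ¬ (a ∈ I ∧ b ∈ I) → (w₁.sub I).diagram = (w₂.sub I).diagram := by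
    intro I hI
    refine FramedWord.diagram_eq ?_ fun x _ => by simp [FramedWord.sub, f₁, f₂]
    by_cases h : a ∈ I <;> by_cases h' : b ∈ I <;>
      simp_all [FramedWord.sub]
  have p₃₄ : ∀ I : Finset ℕ, ¬ (a ∈ I ∧ b ∈ I) → w₃.framing = w₄.framing →
      (w₃.sub I).diagram = (w₄.sub I).diagram := by
    intro I hI hf
    refine FramedWord.diagram_eq ?_ fun x _ => by simp [FramedWord.sub, hf]
    by_cases h : a ∈ I <;> by_cases h' : b ∈ I <;>
      simp_all [FramedWord.sub]
  have p₁₃ : ∀ I : Finset ℕ, a ∉ I → b ∉ I → (∀ x, x ≠ a → w₃.framing x = w₁.framing x) →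
      (w₁.sub I).diagram = (w₃.sub I).diagram := by
    intro I h h' hf
    refine FramedWord.diagram_eq (by simp [FramedWord.sub, h₁, h₃, h, h']) fun x hx => hf x ?_
    rintro rfl
    simp [FramedWord.sub, h] at hx
  have main : ∀ ε : K, w₃.framing = w₄.framing → (∀ x, x ≠ a → w₃.framing x = w₁.framing x) →
      (∀ J : Finset ℕ, a ∈ J → b ∈ J →
        ((w₁.sub J).diagram.toM K - (w₂.sub J).diagram.toM K)
          - ε • ((w₃.sub J).diagram.toM K - (w₄.sub J).diagram.toM K) = 0) →
      (coproductDiagram K w₁.diagram - coproductDiagram K w₂.diagram)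
        - ε • (coproductDiagram K w₃.diagram - coproductDiagram K w₄.diagram) = 0 := by
    intro ε hf hf' four
    simp only [coproductDiagram_diagram, c₂, c₃, c₄, ← Finset.sum_sub_distrib, Finset.smul_sum]
    refine Finset.sum_eq_zero fun I _ => ?_
    simp only [FramedWord.coterm, c₂, c₃, c₄]
    by_cases h : a ∈ I <;> by_cases h' : b ∈ I
    · have n : a ∉ w₁.chords \ I := by simp [h]
      have n' : b ∉ w₁.chords \ I := by simp [h']
      rw [← p₃₄ (w₁.chords \ I) (by tauto) hf, ← p₁₃ _ n n' hf',
        ← p₁₂ (w₁.chords \ I) (by tauto), ← TensorProduct.sub_tmul, ← TensorProduct.sub_tmul,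
        TensorProduct.smul_tmul', ← TensorProduct.sub_tmul, four I h h', TensorProduct.zero_tmul]
    · have n : ¬ (a ∈ w₁.chords \ I ∧ b ∈ w₁.chords \ I) := by simp [h]
      rw [p₁₂ I (by tauto), p₁₂ _ n, p₃₄ I (by tauto) hf, p₃₄ _ n hf]
      simp
    · have n : ¬ (a ∈ w₁.chords \ I ∧ b ∈ w₁.chords \ I) := by simp [h']
      rw [p₁₂ I (by tauto), p₁₂ _ n, p₃₄ I (by tauto) hf, p₃₄ _ n hf]
      simp
    · rw [← p₃₄ I (by tauto) hf, ← p₁₃ _ h h' hf', ← p₁₂ I (by tauto), ← TensorProduct.tmul_sub,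
        ← TensorProduct.tmul_sub, ← TensorProduct.tmul_smul, ← TensorProduct.tmul_sub,
        four _ (by simp [ha, h]) (by simp [hb, h']), TensorProduct.tmul_zero]
  rcases H with ⟨hfb, f₃, f₄, rfl⟩ | ⟨hfb, f₃, f₄, rfl⟩
  · simp only [SetLike.mem_coe, LinearMap.mem_ker, map_sub, Finsupp.linearCombination_single,
      one_smul]
    have := main (-1) (f₃.trans f₄.symm) (fun x _ => by rw [f₃, f₁]) ?_
    · have e := neg_one_smul K (coproductDiagram K w₃.diagram - coproductDiagram K w₄.diagram)
      have t := this.symm.trans (congrArg _ e)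
      rw [neg_sub] at t
      exact t.symm
    intro J h h'
    rw [neg_smul, one_smul, neg_sub]
    refine toM_fourTerm_oriented K (a := a) (b := b) (P := P.filter (· ∈ J))
        (Q := Q.filter (· ∈ J)) ?_ ?_ ?_ ?_ ?_ ?_ ?_ ?_ <;>
      simp [FramedWord.sub, h₁, h₂, h₃, h₄, f₁, f₂, f₃, f₄, h, h', hfb]
  · simp only [SetLike.mem_coe, LinearMap.mem_ker, map_sub, Finsupp.linearCombination_single,
      one_smul]
    have := main 1 (f₃.trans f₄.symm) (fun x hx => by simp [f₃, f₁, hx]) ?_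
    · rwa [one_smul] at this
    intro J h h'
    rw [one_smul]
    refine toM_fourTerm_disorienting K (a := a) (b := b) (P := P.filter (· ∈ J))
        (Q := Q.filter (· ∈ J)) ?_ ?_ ?_ ?_ ?_ ?_ ?_ ?_ <;>
      simp [FramedWord.sub, h₁, h₂, h₃, h₄, f₁, f₂, f₃, f₄, h, h', hfb]

/-- The coproduct `ℳ → ℳ ⊗ ℳ`. -/
noncomputable def coproductM : SpaceM K →ₗ[K] SpaceM K ⊗[K] SpaceM K :=
  extendM K (coproductDiagram K) (coproductDiagram_fourTerm K)

/-- The coaction `ℳ → 𝒜 ⊗ ℳ`. -/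
noncomputable def coactionM : SpaceM K →ₗ[K] SpaceA K ⊗[K] SpaceM K :=
  (TensorProduct.map (prM K) LinearMap.id).comp (coproductM K)

/-- The space of covariant elements: those `v` with `δ v = 1 ⊗ v`. -/
noncomputable def covariantM : Submodule K (SpaceM K) :=
  LinearMap.eqLocus (coactionM K) (TensorProduct.mk K (SpaceA K) (SpaceM K) (oneA K))

/-! ### The product `𝒜 ⊗ ℳ → ℳ` -/

/-- Names for the chords of a pair of diagrams: the bijection `ℕ ⊕ ℕ ≃ ℕ` onto the even and the odd
numbers. -/
def chordSum : ℕ ⊕ ℕ ≃ ℕ := Equiv.natSumNatEquivNat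

/-- The diagram obtained by glueing a cut chord diagram, all chords of which become oriented, and a
cut framed chord diagram. The chords are renamed so that those of the two factors differ. -/
def glue (c : ChordWord) (d : FramedWord) : FramedWord where
  letters := c.letters.map (fun n => chordSum (Sum.inl n)) ++
    d.letters.map (fun n => chordSum (Sum.inr n))
  double := by
    have il : Function.Injective (fun n : ℕ => chordSum (Sum.inl n)) :=
      chordSum.injective.comp Sum.inl_injective
    have ir : Function.Injective (fun n : ℕ => chordSum (Sum.inr n)) :=
      chordSum.injective.comp Sum.inr_injective
    intro x hx
    rw [List.mem_append] at hx
    rw [List.count_append]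
    rcases hx with hx | hx
    · obtain ⟨n, hn, rfl⟩ := List.mem_map.1 hx
      rw [List.count_map_of_injective _ _ il, c.double n hn, List.count_eq_zero_of_not_mem]
      simp
    · obtain ⟨n, hn, rfl⟩ := List.mem_map.1 hx
      rw [List.count_map_of_injective _ _ ir, d.double n hn, List.count_eq_zero_of_not_mem]
      simp
  framing := fun n => Sum.elim (fun _ => 0) d.framing (chordSum.symm n)

open Classical in
/-- The class of the framed diagram with given word and framing (`0` if the word is not double). -/
noncomputable def wordClass (l : List ℕ) (f : ℕ → ZMod 2) : SpaceM K :=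
  if h : IsDouble l then (FramedWord.diagram ⟨⟨l, h⟩, f⟩).toM K else 0

theorem wordClass_letters (d : FramedWord) : wordClass K d.letters d.framing = d.diagram.toM K :=
  dif_pos d.double

theorem IsDouble.perm {l l' : List ℕ} (h : IsDouble l) (p : l.Perm l') : IsDouble l' := by
  intro x hx
  rw [← p.count_eq]
  exact h x (p.mem_iff.2 hx)

theorem wordClass_rotate {l l' : List ℕ} (h : l ~r l') (f : ℕ → ZMod 2) :
    wordClass K l f = wordClass K l' f := by
  by_cases hl : IsDouble l
  · have hl' := hl.perm h.perm
    rw [wordClass, wordClass, dif_pos hl, dif_pos hl']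
    congr 1
    exact Quotient.sound ⟨1, by simpa using h, by simp⟩
  · have hl' : ¬ IsDouble l' := fun h' => hl (h'.perm h.perm.symm)
    rw [wordClass, wordClass, dif_neg hl, dif_neg hl']

theorem wordClass_fourTerm (a b : ℕ) (P Q : List ℕ) (f : ℕ → ZMod 2) (hb : f b = 0) :
    (wordClass K (a :: b :: (P ++ b :: Q)) f - wordClass K (b :: a :: (P ++ b :: Q)) f) +
      (wordClass K (b :: (P ++ a :: b :: Q)) f - wordClass K (b :: (P ++ b :: a :: Q)) f) = 0 := by
  have p₂ : (a :: b :: (P ++ b :: Q)).Perm (b :: a :: (P ++ b :: Q)) := List.Perm.swap _ _ _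
  have p₃ : (a :: b :: (P ++ b :: Q)).Perm (b :: (P ++ a :: b :: Q)) :=
    p₂.trans (List.Perm.cons _ List.perm_middle.symm)
  have p₄ : (a :: b :: (P ++ b :: Q)).Perm (b :: (P ++ b :: a :: Q)) :=
    p₃.trans (List.Perm.cons _ (List.Perm.append_left _ (List.Perm.swap _ _ _)))
  by_cases h : IsDouble (a :: b :: (P ++ b :: Q))
  · have := toM_fourTerm_oriented K (w₁ := ⟨⟨_, h⟩, f⟩) (w₂ := ⟨⟨_, h.perm p₂⟩, f⟩)
      (w₃ := ⟨⟨_, h.perm p₃⟩, f⟩) (w₄ := ⟨⟨_, h.perm p₄⟩, f⟩) rfl rfl rfl rfl rfl rfl rfl hb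
    simp only [wordClass, dif_pos h, dif_pos (h.perm p₂), dif_pos (h.perm p₃),
      dif_pos (h.perm p₄)]
    rw [← this]
    abel
  · have h₂ : ¬ IsDouble (b :: a :: (P ++ b :: Q)) := fun h' => h (h'.perm p₂.symm)
    have h₃ : ¬ IsDouble (b :: (P ++ a :: b :: Q)) := fun h' => h (h'.perm p₃.symm)
    have h₄ : ¬ IsDouble (b :: (P ++ b :: a :: Q)) := fun h' => h (h'.perm p₄.symm)
    simp [wordClass, dif_neg h, dif_neg h₂, dif_neg h₃, dif_neg h₄]

theorem getD_eq_iff_of_two (A B C : List ℕ) (y : ℕ) (hA : y ∉ A) (hB : y ∉ B) (hC : y ∉ C)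
    (i : ℕ) : (i < (A ++ y :: (B ++ y :: C)).length ∧ (A ++ y :: (B ++ y :: C)).getD i 0 = y) ↔
      i = A.length ∨ i = (A ++ y :: B).length := by
  constructor
  · rintro ⟨hi, h⟩
    rw [List.getD_eq_getElem _ _ hi] at h
    grind
  · rintro (rfl | rfl)
    · simp
    · have : A ++ y :: (B ++ y :: C) = (A ++ y :: B) ++ y :: C := by simp
      rw [this]
      exact ⟨by simp, by rw [List.getD_append_right _ _ _ _ le_rfl]; simp⟩

/-- An endpoint `x` may be moved through a part `U` of the circle that contains both ends of each
of its chords (except for `x` itself) and only oriented chords. -/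
theorem wordClass_move (x : ℕ) (U V : List ℕ) (f : ℕ → ZMod 2)
    (hU : ∀ y ∈ U, y ≠ x → U.count y = 2 ∧ f y = 0) :
    wordClass K (x :: (U ++ V)) f = wordClass K (U ++ x :: V) f := by
  let F : ℕ → SpaceM K := fun i => wordClass K (U.take i ++ x :: (U.drop i ++ V)) f
  have hF : F 0 - F U.length = ∑ i ∈ Finset.range U.length, (F i - F (i + 1)) :=
    (Finset.sum_range_sub' F U.length).symm
  suffices h : ∑ i ∈ Finset.range U.length, (F i - F (i + 1)) = 0 by
    rw [h, sub_eq_zero] at hF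
    simpa [F] using hF
  have step : ∀ (A B : List ℕ) (y : ℕ), U = A ++ y :: B → F A.length - F (A.length + 1) =
      wordClass K (A ++ x :: y :: (B ++ V)) f - wordClass K (A ++ y :: x :: (B ++ V)) f := by
    rintro A B y e
    have e' : A ++ y :: B = (A ++ [y]) ++ B := by simp
    have l' : A.length + 1 = (A ++ [y]).length := by simp
    congr 1
    · simp only [F, e, List.take_left, List.drop_left, List.cons_append]
    · simp only [F, e, e', l', List.take_left, List.drop_left]
      simp
  rw [← Finset.sum_fiberwise_of_maps_to (s := Finset.range U.length) (t := U.toFinset)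
    (g := fun i => U.getD i 0)]
  · refine Finset.sum_eq_zero fun y hy => ?_
    rw [List.mem_toFinset] at hy
    by_cases hyx : y = x
    · refine Finset.sum_eq_zero fun i hi => ?_
      rw [Finset.mem_filter, Finset.mem_range] at hi
      obtain ⟨hi, e⟩ := hi
      rw [List.getD_eq_getElem _ _ hi] at e
      have := step (U.take i) (U.drop (i + 1)) y (by rw [← e]; simp)
      rw [List.length_take_of_le hi.le] at this
      rw [this, hyx, sub_self]
    · obtain ⟨hc, hfy⟩ := hU y hy hyx
      obtain ⟨A, B, rfl, hA⟩ := List.eq_append_cons_of_mem hy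
      have hcA : A.count y = 0 := List.count_eq_zero_of_not_mem hA
      have hcB : B.count y = 1 := by simp [hcA] at hc; omega
      have hyB : y ∈ B := List.count_pos_iff.1 (by omega)
      obtain ⟨B, C, rfl, hB⟩ := List.eq_append_cons_of_mem hyB
      have hcB' : B.count y = 0 := List.count_eq_zero_of_not_mem hB
      have hC : y ∉ C := by
        rw [← List.count_eq_zero]; simp [hcB'] at hcB; simpa using hcB
      have hs : (Finset.range (A ++ y :: (B ++ y :: C)).length).filter
          (fun i => (A ++ y :: (B ++ y :: C)).getD i 0 = y) =
          {A.length, (A ++ y :: B).length} := by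
        ext i
        simp only [Finset.mem_filter, Finset.mem_range, Finset.mem_insert, Finset.mem_singleton]
        exact getD_eq_iff_of_two A B C y hA hB hC i
      rw [hs, Finset.sum_pair (by simp), step A (B ++ y :: C) y rfl,
        step (A ++ y :: B) C y (by simp)]
      have key := wordClass_fourTerm K x y B (C ++ V ++ A) f hfy
      rw [← key]
      congr 2
      · refine wordClass_rotate K ?_ f
        simpa using List.isRotated_append (l := A) (l' := x :: y :: (B ++ y :: (C ++ V)))
      · refine wordClass_rotate K ?_ f
        simpa using List.isRotated_append (l := A) (l' := y :: x :: (B ++ y :: (C ++ V)))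
      · refine wordClass_rotate K ?_ f
        simpa using List.isRotated_append (l := A) (l' := y :: (B ++ x :: y :: (C ++ V)))
      · refine wordClass_rotate K ?_ f
        simpa using List.isRotated_append (l := A) (l' := y :: (B ++ y :: x :: (C ++ V)))
  · intro i hi
    rw [Finset.mem_range] at hi
    rw [List.mem_toFinset, List.getD_eq_getElem _ _ hi]
    exact List.getElem_mem hi

theorem wordClass_relabel (ρ : Equiv.Perm ℕ) (l : List ℕ) (f f' : ℕ → ZMod 2)
    (h : ∀ x ∈ l, f' (ρ x) = f x) : wordClass K l f = wordClass K (l.map ρ) f' := by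
  have iff : IsDouble (l.map ρ) ↔ IsDouble l := by
    simp only [IsDouble, List.forall_mem_map, List.count_map_of_injective _ _ ρ.injective]
  by_cases hl : IsDouble l
  · have hl' := iff.2 hl
    rw [wordClass, wordClass, dif_pos hl, dif_pos hl']
    congr 1
    exact Quotient.sound ⟨ρ, List.IsRotated.refl _, h⟩
  · rw [wordClass, wordClass, dif_neg hl, dif_neg (mt iff.1 hl)]

theorem wordClass_rotate_left {C C' : List ℕ} (h : C ~r C') (D : List ℕ) (f : ℕ → ZMod 2)
    (hC : IsDouble C) (hf : ∀ x ∈ C, f x = 0) :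
    wordClass K (C ++ D) f = wordClass K (C' ++ D) f := by
  obtain ⟨n, rfl⟩ := h
  induction n generalizing C with
  | zero => simp
  | succ n ih =>
    cases C with
    | nil => simp
    | cons x C =>
      have p : (x :: C).Perm (C ++ [x]) := (List.perm_append_singleton x C).symm
      rw [List.rotate_cons_succ, ← ih (hC.perm p) (fun y hy => hf y (p.mem_iff.2 hy))]
      have := wordClass_move K x C D f fun y hy hyx => ⟨?_, hf y (List.mem_cons_of_mem _ hy)⟩
      · simpa using this
      · rw [← hC y (List.mem_cons_of_mem _ hy), List.count_cons_of_ne (Ne.symm hyx)]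

theorem wordClass_rotate_right {D D' : List ℕ} (h : D ~r D') (C : List ℕ) (f : ℕ → ZMod 2)
    (hC : IsDouble C) (hf : ∀ x ∈ C, f x = 0) :
    wordClass K (C ++ D) f = wordClass K (C ++ D') f := by
  obtain ⟨n, rfl⟩ := h
  induction n generalizing D with
  | zero => simp
  | succ n ih =>
    cases D with
    | nil => simp
    | cons x D =>
      rw [List.rotate_cons_succ, ← ih,
        ← wordClass_move K x C D f fun y hy _ => ⟨hC y hy, hf y hy⟩]
      refine wordClass_rotate K ?_ f
      simpa using List.isRotated_append (l := [x]) (l' := C ++ D)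

/-- The product of diagrams does not depend on the cut points and the names of the chords. -/
theorem toM_glue_congr {c c' : ChordWord} {d d' : FramedWord} (hc : c ≈ c') (hd : d ≈ d') :
    (glue c d).diagram.toM K = (glue c' d').diagram.toM K := by
  obtain ⟨σ, hσ⟩ := hc
  obtain ⟨τ, hτ, hf⟩ := hd
  have il : Function.Injective (fun n : ℕ => chordSum (Sum.inl n)) :=
    chordSum.injective.comp Sum.inl_injective
  let ρ : Equiv.Perm ℕ :=
    (chordSum.symm.trans (Equiv.sumCongr σ τ)).trans chordSum
  rw [← wordClass_letters, ← wordClass_letters,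
    wordClass_relabel K ρ _ _ (glue c' d').framing]
  · have hmap : (glue c d).letters.map ρ =
        (c.letters.map σ).map (fun n => chordSum (Sum.inl n)) ++
        (d.letters.map τ).map (fun n => chordSum (Sum.inr n)) := by
      simp only [glue, List.map_append, List.map_map]
      congr 1 <;> refine List.map_congr_left fun n _ => ?_ <;>
        simp [ρ]
    have h0 : ∀ l : List ℕ,
        ∀ x ∈ l.map (fun n => chordSum (Sum.inl n)),
          (glue c' d').framing x = 0 := by
      intro l x hx
      obtain ⟨n, -, rfl⟩ := List.mem_map.1 hx
      simp [glue]
    have hdbl : IsDouble (c'.letters.map (fun n => chordSum (Sum.inl n))) := by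
      intro x hx
      obtain ⟨n, hn, rfl⟩ := List.mem_map.1 hx
      rw [List.count_map_of_injective _ _ il]
      exact c'.double n hn
    have hrot := hσ.map (fun n => chordSum (Sum.inl n))
    rw [hmap, wordClass_rotate_left K hrot _ _ (hdbl.perm hrot.perm.symm) (h0 _),
      wordClass_rotate_right K (hτ.map _) _ _ hdbl (h0 _)]
    rfl
  · intro x hx
    simp only [glue, List.mem_append, List.mem_map] at hx
    rcases hx with ⟨n, hn, rfl⟩ | ⟨n, hn, rfl⟩
    · simp [glue, ρ]
    · simpa [glue, ρ] using hf n hn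

/-- The product of a chord diagram by a framed chord diagram. -/
noncomputable def mulDiagram : ChordDiagram → FramedChordDiagram → SpaceM K :=
  Quotient.lift₂ (fun c d => (glue c d).diagram.toM K)
    (fun _ _ _ _ hc hd => toM_glue_congr K hc hd)

theorem mulDiagram_diagram (c : ChordWord) (d : FramedWord) :
    mulDiagram K c.diagram d.diagram = (glue c d).diagram.toM K := rfl

theorem mulDiagram_fourTerm_right (c : ChordDiagram) :
    framedFourTerm K ⊆ LinearMap.ker (Finsupp.linearCombination K (mulDiagram K c)) := by
  obtain ⟨c, rfl⟩ : ∃ c' : ChordWord, c'.diagram = c := Quotient.exists_rep c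
  -- glueing in the other order, the words of the four diagrams have the form of a 4T-relation
  let C : List ℕ := c.letters.map (fun n => chordSum (Sum.inl n))
  let swap : FramedWord → FramedWord := fun d =>
    ⟨⟨d.letters.map (fun n => chordSum (Sum.inr n)) ++ C,
      (glue c d).double.perm List.perm_append_comm⟩, (glue c d).framing⟩
  have hswap : ∀ d, mulDiagram K c.diagram d.diagram = (swap d).diagram.toM K := by
    intro d
    rw [mulDiagram_diagram]
    congr 1
    exact Quotient.sound ⟨1, by simpa [glue, swap, C] using List.isRotated_append, by simp [swap]⟩
  rintro v ⟨a, b, P, Q, f, w₁, w₂, w₃, w₄, h₁, h₂, h₃, h₄, f₁, f₂, H⟩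
  rcases H with ⟨hfb, f₃, f₄, rfl⟩ | ⟨hfb, f₃, f₄, rfl⟩
  · simp only [SetLike.mem_coe, LinearMap.mem_ker, map_sub, Finsupp.linearCombination_single,
      one_smul, hswap]
    refine toM_fourTerm_oriented K (a := chordSum (Sum.inr a))
      (b := chordSum (Sum.inr b))
      (P := P.map (fun n => chordSum (Sum.inr n)))
      (Q := Q.map (fun n => chordSum (Sum.inr n)) ++ C) ?_ ?_ ?_ ?_ ?_ ?_ ?_ ?_ <;>
    simp [swap, glue, h₁, h₂, h₃, h₄, f₁, f₂, f₃, f₄, hfb]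
  · simp only [SetLike.mem_coe, LinearMap.mem_ker, map_sub, Finsupp.linearCombination_single,
      one_smul, hswap]
    have hup : ∀ w : FramedWord, w.framing = Function.update f a (f a + 1) →
        (swap w).framing = Function.update (swap w₁).framing
          (chordSum (Sum.inr a))
          ((swap w₁).framing (chordSum (Sum.inr a)) + 1) := by
      intro w hw
      funext x
      obtain ⟨y, rfl⟩ := chordSum.surjective x
      rcases y with n | n
      · simp [swap, glue]
      · simp [swap, glue, Function.update_apply, hw, f₁]
    refine toM_fourTerm_disorienting K (a := chordSum (Sum.inr a))
      (b := chordSum (Sum.inr b))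
      (P := P.map (fun n => chordSum (Sum.inr n)))
      (Q := Q.map (fun n => chordSum (Sum.inr n)) ++ C)
      ?_ ?_ ?_ ?_ ?_ (hup w₃ f₃) (hup w₄ f₄) ?_ <;>
    simp [swap, glue, h₁, h₂, h₃, h₄, f₁, f₂, hfb]

/-- The product of a chord diagram by an element of `ℳ`. -/
noncomputable def mulByDiagram (c : ChordDiagram) : SpaceM K →ₗ[K] SpaceM K :=
  extendM K (mulDiagram K c) (mulDiagram_fourTerm_right K c)

theorem mulByDiagram_fourTerm :
    fourTerm K ⊆ LinearMap.ker (Finsupp.linearCombination K (mulByDiagram K)) := by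
  rintro v ⟨a, b, P, Q, w₁, w₂, w₃, w₄, h₁, h₂, h₃, h₄, rfl⟩
  simp only [SetLike.mem_coe, LinearMap.mem_ker, map_sub, Finsupp.linearCombination_single,
    one_smul]
  refine Submodule.linearMap_qext _ (Finsupp.lhom_ext' fun d => LinearMap.ext_ring ?_)
  obtain ⟨d, rfl⟩ : ∃ d' : FramedWord, d'.diagram = d := Quotient.exists_rep d
  have key : ∀ c : ChordWord, mulByDiagram K c.diagram (d.diagram.toM K) =
      (glue c d).diagram.toM K := fun c => extendM_toM K _ _ _
  change (mulByDiagram K w₁.diagram (d.diagram.toM K) - mulByDiagram K w₂.diagram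
    (d.diagram.toM K)) - (mulByDiagram K w₄.diagram (d.diagram.toM K) -
    mulByDiagram K w₃.diagram (d.diagram.toM K)) = 0
  simp only [key]
  refine toM_fourTerm_oriented K (a := chordSum (Sum.inl a))
      (b := chordSum (Sum.inl b))
      (P := P.map (fun n => chordSum (Sum.inl n)))
      (Q := Q.map (fun n => chordSum (Sum.inl n)) ++
        d.letters.map (fun n => chordSum (Sum.inr n)))
      ?_ ?_ ?_ ?_ ?_ ?_ ?_ ?_ <;>
    simp [glue, h₁, h₂, h₃, h₄]

/-- The product `𝒜 ⊗ ℳ → ℳ`, as a bilinear map. -/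
noncomputable def mulM : SpaceA K →ₗ[K] SpaceM K →ₗ[K] SpaceM K :=
  extendA K (mulByDiagram K) (mulByDiagram_fourTerm K)

/-! ### Homogeneous functionals and their products -/

/-- A functional on `ℳ` is homogeneous of degree `n` if it vanishes on the diagrams whose number of
chords is not `n`. -/
def IsHomogeneousM (n : ℕ) (s : SpaceM K →ₗ[K] K) : Prop :=
  ∀ d : FramedChordDiagram, d.order ≠ n → s (d.toM K) = 0

/-- Homogeneous functionals on `𝒜`. -/
def IsHomogeneousA (n : ℕ) (φ : SpaceA K →ₗ[K] K) : Prop :=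
  ∀ c : ChordDiagram, c.order ≠ n → φ (c.toA K) = 0

/-- Homogeneous functionals on the space of covariant elements: they vanish on the white diagrams
whose number of chords is not `n`. -/
def IsHomogeneousCo (n : ℕ) (ψ : covariantM K →ₗ[K] K) : Prop :=
  ∀ d : FramedChordDiagram, d.IsWhite → d.order ≠ n →
    ∀ h : d.toM K ∈ covariantM K, ψ ⟨d.toM K, h⟩ = 0

/-- The functional `t` on `ℳ` is the product of the functional `φ` on `𝒜` by the functional `ψ` on
the space of covariant elements. -/
def IsProductFunctional (t : SpaceM K →ₗ[K] K) (φ : SpaceA K →ₗ[K] K)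
    (ψ : covariantM K →ₗ[K] K) : Prop :=
  ∀ (c : SpaceA K) (v : covariantM K), t (mulM K c v) = φ c * ψ v

end Spaces

/-! Let a be a black and b a white chord with neighbouring endpoints. The 4T-relation with shared
chord b says that exchanging these endpoints changes the diagram by two diagrams in which a has
become white. So, modulo diagrams with fewer black chords, the endpoints of black and white chords
commute. Sorting a word until all black letters come first gives a product c · w, and induction on
the number of black chords proves the second assertion (`wordClass_mem_blackWhiteSpan`).

White diagrams are covariant, because `Pr` kills every subdiagram that has a white chord. For the
converse, write δ(m) = ∑ m₀ ⊗ m₁ and define p recursively by p(m) = m - ∑ m₀ · p(m₁), the sum being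
over the terms with m₀ of positive degree (`covariantProj`, `covariantProj_eq`). A covariant element
has no such terms, so p fixes it. On c · w with c nonempty, induction kills every term except the
one with m₀ = c, which is c · p(w) = c · w; hence p(c · w) = 0 (`covariantProj_eq_zero`). Since the
products c · w span ℳ, the image of p lies in the span of the white diagrams, and with it every
covariant element.

The map (id ⊗ p) ∘ δ then sends c · v to c ⊗ v for covariant v (`splitM_mulM`), so φ · ψ exists for
any φ and ψ. The homogeneous parts of 𝒜 are finite-dimensional. If e₁, e₂, … is a basis of the part
of degree k with dual basis φ₁, φ₂, …, then s is the sum over k ≤ n and i of φᵢ · s(eᵢ · -). -/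

/-! ### Words and relabellings -/

/-- An injection of a finite set of names extends to a permutation of all names. -/
theorem exists_perm_eq_on_finset (s : Finset ℕ) (f : ℕ → ℕ) (hf : Set.InjOn f s) :
    ∃ ρ : Equiv.Perm ℕ, ∀ x ∈ s, ρ x = f x := by
  classical
  have i₁ : Infinite ((s : Set ℕ)ᶜ : Set ℕ) := s.finite_toSet.infinite_compl.to_subtype
  have i₂ : Infinite ((f '' (s : Set ℕ))ᶜ : Set ℕ) :=
    (s.finite_toSet.image f).infinite_compl.to_subtype
  obtain ⟨e⟩ : Nonempty (((s : Set ℕ)ᶜ : Set ℕ) ≃ ((f '' (s : Set ℕ))ᶜ : Set ℕ)) :=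
    nonempty_equiv_of_countable
  refine ⟨(Equiv.Set.sumCompl (s : Set ℕ)).symm.trans
    ((Equiv.sumCongr (Equiv.Set.imageOfInjOn f s hf) e).trans (Equiv.Set.sumCompl _)),
    fun x hx => ?_⟩
  simp [Equiv.Set.sumCompl_symm_apply_of_mem (s := (s : Set ℕ)) hx, Equiv.Set.imageOfInjOn]

/-! ### Double words and the number of chord diagrams of a given order. -/

theorem IsDouble.length_eq {l : List ℕ} (h : IsDouble l) : l.length = 2 * l.toFinset.card := by
  rw [← List.sum_toFinset_count_eq_length, Finset.sum_congr rfl fun x hx =>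
    h x (List.mem_toFinset.1 hx), Finset.sum_const, smul_eq_mul, mul_comm]

theorem IsDouble.filter {l : List ℕ} (h : IsDouble l) (p : ℕ → Bool) :
    IsDouble (l.filter p) := by
  intro x hx
  rw [List.mem_filter] at hx
  rw [List.count_filter hx.2]
  exact h x hx.1

theorem IsDouble.map {l : List ℕ} (h : IsDouble l) {g : ℕ → ℕ} (hg : Function.Injective g) :
    IsDouble (l.map g) := by
  simpa only [IsDouble, List.forall_mem_map, List.count_map_of_injective _ _ hg] using h

/-- Numbering the chords from 0 to k - 1 presents the diagram by a word of length 2k in k letters,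
and there are finitely many such words. -/
theorem ChordDiagram.finite_order_eq (k : ℕ) : {c : ChordDiagram | c.order = k}.Finite := by
  classical
  -- The empty diagram is a dummy value: only double words are needed to reach the diagrams of order
  -- k.
  let g : List ℕ → ChordDiagram := fun l =>
    if h : IsDouble l then ChordWord.diagram ⟨l, h⟩
    else ChordWord.diagram ⟨[], by simp [IsDouble]⟩
  have hfin : {l : List ℕ | l.length = 2 * k ∧ ∀ x ∈ l, x < k}.Finite := by
    refine ((List.finite_length_eq (Fin k) (2 * k)).image (List.map Fin.val)).subset ?_
    rintro l ⟨hl, hx⟩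
    refine ⟨l.pmap Fin.mk hx, by simpa using hl, ?_⟩
    rw [List.map_pmap]
    simp
  refine (hfin.image g).subset fun c hc => ?_
  obtain ⟨c, rfl⟩ : ∃ c' : ChordWord, c'.diagram = c := Quotient.exists_rep c
  have hk : c.chords.card = k := hc
  let e : c.chords ≃ Fin k := c.chords.equivFinOfCardEq hk
  obtain ⟨ρ, hρ⟩ := exists_perm_eq_on_finset c.chords
    (fun x => if h : x ∈ c.chords then (e ⟨x, h⟩ : ℕ) else 0) (by
      intro x hx y hy hxy
      rw [Finset.mem_coe] at hx hy
      simp only [hx, hy, dif_pos] at hxy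
      simpa using e.injective (Fin.ext hxy))
  have hd : IsDouble (c.letters.map ρ) := c.double.map ρ.injective
  refine ⟨c.letters.map ρ, ⟨?_, ?_⟩, ?_⟩
  · rw [List.length_map, c.double.length_eq, ← hk, ChordWord.chords]
  · intro x hx
    obtain ⟨y, hy, rfl⟩ := List.mem_map.1 hx
    have hy' : y ∈ c.chords := List.mem_toFinset.2 hy
    rw [hρ y hy', dif_pos hy']
    exact (e ⟨y, hy'⟩).2
  · rw [show g (c.letters.map ρ) = _ from dif_pos hd]
    exact (Quotient.sound ⟨ρ, List.IsRotated.refl _⟩ : c.diagram = _).symm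

/-- The source of the homogeneity of the relations: the four diagrams have the same chords. -/
theorem fourTerm_perm (a b : ℕ) (P Q : List ℕ) :
    (a :: b :: (P ++ b :: Q)).Perm (b :: a :: (P ++ b :: Q)) ∧
    (a :: b :: (P ++ b :: Q)).Perm (b :: (P ++ a :: b :: Q)) ∧
    (a :: b :: (P ++ b :: Q)).Perm (b :: (P ++ b :: a :: Q)) := by
  have p₂ : (a :: b :: (P ++ b :: Q)).Perm (b :: a :: (P ++ b :: Q)) := List.Perm.swap _ _ _
  have p₃ : (a :: b :: (P ++ b :: Q)).Perm (b :: (P ++ a :: b :: Q)) :=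
    p₂.trans (List.Perm.cons _ List.perm_middle.symm)
  exact ⟨p₂, p₃,
    p₃.trans (List.Perm.cons _ (List.Perm.append_left _ (List.Perm.swap _ _ _)))⟩

section

variable (K : Type*) [Field K]

/-! ### Products as concatenations of words. -/

theorem mulM_diagram (c : ChordWord) (d : FramedWord) :
    mulM K (c.diagram.toA K) (d.diagram.toM K) = (glue c d).diagram.toM K := by
  rw [mulM, extendA_toA, mulByDiagram, extendM_toM, mulDiagram_diagram]

/-- A word that is the concatenation of a black word and a word with other chords represents the
product. -/
theorem mulM_eq_wordClass_append (c : ChordWord) (d : FramedWord) (f : ℕ → ZMod 2)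
    (hcd : ∀ x ∈ c.letters, x ∉ d.letters) (hc : ∀ x ∈ c.letters, f x = 0)
    (hd : ∀ x ∈ d.letters, f x = d.framing x) :
    mulM K (c.diagram.toA K) (d.diagram.toM K) = wordClass K (c.letters ++ d.letters) f := by
  classical
  -- `ρ` gives the chords the names that `glue` gives them; since the two sets of chords are
  -- disjoint, one permutation does this for both words.
  obtain ⟨ρ, hρ⟩ := exists_perm_eq_on_finset (c.letters ++ d.letters).toFinset
    (fun x => if x ∈ c.letters then chordSum (Sum.inl x) else chordSum (Sum.inr x)) (by
      intro x _ y _ hxy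
      dsimp only at hxy
      split_ifs at hxy <;> simp at hxy <;> exact hxy)
  have hl : ∀ x ∈ c.letters, ρ x = chordSum (Sum.inl x) := fun x hx => by
    rw [hρ x (by simp [hx]), if_pos hx]
  have hr : ∀ x ∈ d.letters, ρ x = chordSum (Sum.inr x) := fun x hx => by
    rw [hρ x (by simp [hx]), if_neg fun h => hcd x h hx]
  rw [mulM_diagram, ← wordClass_letters, wordClass_relabel K ρ _ f (glue c d).framing]
  · simp only [glue, List.map_append, List.map_congr_left hl, List.map_congr_left hr]
  · intro x hx
    rcases List.mem_append.1 hx with hx | hx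
    · simp [glue, hl x hx, hc x hx]
    · simp [glue, hr x hx, hd x hx]

theorem glue_order (c : ChordWord) (d : FramedWord) :
    (glue c d).diagram.order = c.diagram.order + d.diagram.order := by
  change (glue c d).chords.card = c.chords.card + d.chords.card
  have h₁ := (glue c d).double.length_eq
  have h₂ := c.double.length_eq
  have h₃ := d.double.length_eq
  have h₄ : (glue c d).letters.length = c.letters.length + d.letters.length := by simp [glue]
  simp only [ChordWord.chords]
  omega

/-! ### Sorting the chords by their framing -/

/-- Holds for arbitrary words: the four are permutations of each other, so if one is not double,
none is, and all terms vanish by convention. -/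
theorem wordClass_fourTerm_disorienting (a b : ℕ) (P Q : List ℕ) (f : ℕ → ZMod 2)
    (hb : f b = 1) :
    wordClass K (a :: b :: (P ++ b :: Q)) f - wordClass K (b :: a :: (P ++ b :: Q)) f =
      wordClass K (b :: (P ++ a :: b :: Q)) (Function.update f a (f a + 1)) -
        wordClass K (b :: (P ++ b :: a :: Q)) (Function.update f a (f a + 1)) := by
  obtain ⟨p₂, p₃, p₄⟩ := fourTerm_perm a b P Q
  by_cases h : IsDouble (a :: b :: (P ++ b :: Q))
  · have := toM_fourTerm_disorienting K (w₁ := ⟨⟨_, h⟩, f⟩) (w₂ := ⟨⟨_, h.perm p₂⟩, f⟩)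
      (w₃ := ⟨⟨_, h.perm p₃⟩, Function.update f a (f a + 1)⟩)
      (w₄ := ⟨⟨_, h.perm p₄⟩, Function.update f a (f a + 1)⟩) rfl rfl rfl rfl rfl rfl rfl hb
    simp only [wordClass, dif_pos h, dif_pos (h.perm p₂), dif_pos (h.perm p₃),
      dif_pos (h.perm p₄)]
    exact sub_eq_zero.1 this
  · have h₂ : ¬ IsDouble (b :: a :: (P ++ b :: Q)) := fun h' => h (h'.perm p₂.symm)
    have h₃ : ¬ IsDouble (b :: (P ++ a :: b :: Q)) := fun h' => h (h'.perm p₃.symm)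
    have h₄ : ¬ IsDouble (b :: (P ++ b :: a :: Q)) := fun h' => h (h'.perm p₄.symm)
    simp [wordClass, dif_neg h, dif_neg h₂, dif_neg h₃, dif_neg h₄]

/-- The span of the products of black diagrams by white diagrams. -/
noncomputable def blackWhiteSpan : Submodule K (SpaceM K) :=
  Submodule.span K {m | ∃ (c : ChordDiagram) (w : FramedChordDiagram),
    w.IsWhite ∧ mulM K (c.toA K) (w.toM K) = m}

/-- The black chords of a word. -/
def blackChords (l : List ℕ) (f : ℕ → ZMod 2) : Finset ℕ := l.toFinset.filter (f · = 0)

theorem blackChords_perm {l l' : List ℕ} (h : l.Perm l') (f : ℕ → ZMod 2) :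
    blackChords l f = blackChords l' f := by
  simp only [blackChords, List.toFinset_eq_of_perm _ _ h]

/-- Both endpoints of a chord carry the same framing, so each half of the sorted word is itself
double and the concatenation is a product. -/
theorem wordClass_sorted_mem (l : List ℕ) (f : ℕ → ZMod 2) :
    wordClass K (l.filter (f · = 0) ++ l.filter (f · ≠ 0)) f ∈ blackWhiteSpan K := by
  by_cases h : IsDouble (l.filter (f · = 0) ++ l.filter (f · ≠ 0))
  · have hl : IsDouble l := by
      refine h.perm ?_
      simpa using List.filter_append_perm (fun x => decide (f x = 0)) l
    refine Submodule.subset_span ⟨ChordWord.diagram ⟨_, hl.filter _⟩,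
      FramedWord.diagram ⟨⟨_, hl.filter _⟩, f⟩, ?_,
      mulM_eq_wordClass_append K ⟨_, hl.filter (f · = 0)⟩ ⟨⟨_, hl.filter (f · ≠ 0)⟩, f⟩ f
        ?_ ?_ ?_⟩
    · intro x hx
      have : f x ≠ 0 := by simpa using (List.mem_filter.1 hx).2
      change f x = 1
      generalize f x = t at this
      revert t
      decide
    · intro x hx hx'
      simp_all
    · intro x hx
      simp_all
    · intro x hx
      rfl
  · rw [wordClass, dif_neg h]
    exact zero_mem _

/-- Exchanging neighbouring endpoints of a black and a white chord changes a diagram by diagrams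
with fewer black chords. -/
theorem wordClass_swap_sub_mem {B : ℕ}
    (ih : ∀ l f, (blackChords l f).card < B → wordClass K l f ∈ blackWhiteSpan K)
    (A R : List ℕ) (a b : ℕ) (f : ℕ → ZMod 2) (ha : f a = 0) (hb : f b ≠ 0)
    (hB : (blackChords (A ++ b :: a :: R) f).card ≤ B) :
    wordClass K (A ++ b :: a :: R) f - wordClass K (A ++ a :: b :: R) f ∈ blackWhiteSpan K := by
  have hb1 : f b = 1 := by
    generalize f b = t at hb
    revert t
    decide
  have hab : a ≠ b := by
    rintro rfl
    exact hb ha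
  have r₁ : A ++ b :: a :: R ~r b :: a :: (R ++ A) := by
    simpa using List.isRotated_append (l := A) (l' := b :: a :: R)
  have r₂ : A ++ a :: b :: R ~r a :: b :: (R ++ A) := by
    simpa using List.isRotated_append (l := A) (l' := a :: b :: R)
  rw [wordClass_rotate K r₁, wordClass_rotate K r₂]
  rw [blackChords_perm r₁.perm] at hB
  by_cases hd : IsDouble (b :: a :: (R ++ A))
  · have hmem : b ∈ R ++ A := by
      have := hd b (by simp)
      rw [List.count_cons_self, List.count_cons_of_ne hab] at this
      exact List.count_pos_iff.1 (by omega)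
    -- The other endpoint of `b` cuts the rest of the circle into the arcs `P` and `Q` of the
    -- relation.
    obtain ⟨P, Q, e⟩ := List.append_of_mem hmem
    rw [e] at hB ⊢
    rw [← neg_sub, wordClass_fourTerm_disorienting K a b P Q f hb1]
    -- On the other side of the relation `a` has framing 1, so it leaves the set of black chords and
    -- nothing enters.
    have less : ∀ l : List ℕ, l.Perm (b :: a :: (P ++ b :: Q)) →
        wordClass K l (Function.update f a (f a + 1)) ∈ blackWhiteSpan K := by
      intro l hl
      refine ih _ _ (lt_of_lt_of_le (Finset.card_lt_card ?_) hB)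
      rw [blackChords_perm hl, Finset.ssubset_iff_of_subset]
      · exact ⟨a, by simp [blackChords, ha], by simp [blackChords, ha]⟩
      · intro x hx
        simp only [blackChords, Finset.mem_filter] at hx ⊢
        refine ⟨hx.1, ?_⟩
        by_cases hxa : x = a
        · rw [hxa, ha]
        · simpa [hxa] using hx.2
    refine neg_mem (sub_mem (less _ ?_) (less _ ?_))
    · exact List.Perm.cons _ List.perm_middle
    · refine List.Perm.cons _ ?_
      exact (List.Perm.append_left _ (List.Perm.swap _ _ _)).trans List.perm_middle
  · have hd' : ¬ IsDouble (a :: b :: (R ++ A)) := fun h => hd (h.perm (List.Perm.swap _ _ _))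
    simp [wordClass, dif_neg hd, dif_neg hd']

/-- Telescoping sum of exchanges: the white endpoint `b` passes the letters of `U` one by one, each
joining the prefix `A` once passed. -/
theorem wordClass_move_white_sub_mem {B : ℕ}
    (ih : ∀ l f, (blackChords l f).card < B → wordClass K l f ∈ blackWhiteSpan K)
    (A U R : List ℕ) (b : ℕ) (f : ℕ → ZMod 2) (hU : ∀ x ∈ U, f x = 0) (hb : f b ≠ 0)
    (hB : (blackChords (A ++ b :: (U ++ R)) f).card ≤ B) :
    wordClass K (A ++ b :: (U ++ R)) f - wordClass K (A ++ (U ++ b :: R)) f ∈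
      blackWhiteSpan K := by
  induction U generalizing A with
  | nil => simp
  | cons a U ihU =>
    have p : (A ++ b :: a :: (U ++ R)).Perm ((A ++ [a]) ++ b :: (U ++ R)) := by
      simpa using List.Perm.append_left A (List.Perm.swap a b _)
    have h₁ := wordClass_swap_sub_mem K ih A (U ++ R) a b f (hU a (by simp)) hb hB
    have h₂ := ihU (A ++ [a]) (fun x hx => hU x (by simp [hx]))
      (by rwa [← blackChords_perm p])
    have := add_mem h₁ h₂
    simpa using this

/-- Insertion sort behind a fixed prefix `A`: the tail is sorted with its first letter counted in
the prefix, and a white first letter is then moved across the black letters of the sorted tail. -/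
theorem wordClass_sort_sub_mem {B : ℕ}
    (ih : ∀ l f, (blackChords l f).card < B → wordClass K l f ∈ blackWhiteSpan K)
    (A l : List ℕ) (f : ℕ → ZMod 2) (hB : (blackChords (A ++ l) f).card ≤ B) :
    wordClass K (A ++ l) f -
      wordClass K (A ++ (l.filter (f · = 0) ++ l.filter (f · ≠ 0))) f ∈ blackWhiteSpan K := by
  induction l generalizing A with
  | nil => simp
  | cons x l ihl =>
    have h := ihl (A ++ [x]) (by simpa using hB)
    by_cases hx : f x = 0
    · simpa [hx] using h
    · have p : (A ++ x :: l).Perm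
          (A ++ x :: (l.filter (f · = 0) ++ l.filter (f · ≠ 0))) := by
        refine List.Perm.append_left _ (List.Perm.cons _ ?_)
        simpa using (List.filter_append_perm (fun x => decide (f x = 0)) l).symm
      have h' := wordClass_move_white_sub_mem K ih A (l.filter (f · = 0)) (l.filter (f · ≠ 0))
        x f (by simp) hx (by rwa [← blackChords_perm p])
      have := add_mem h h'
      simpa [hx] using this

theorem wordClass_mem_blackWhiteSpan (l : List ℕ) (f : ℕ → ZMod 2) :
    wordClass K l f ∈ blackWhiteSpan K := by
  induction hB : (blackChords l f).card using Nat.strong_induction_on generalizing l f with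
  | _ B ih =>
    have h := wordClass_sort_sub_mem K (B := B) (fun l f h => ih _ h l f rfl) [] l f hB.le
    have := add_mem h (wordClass_sorted_mem K l f)
    simpa using this

theorem toM_mem_blackWhiteSpan (d : FramedChordDiagram) : d.toM K ∈ blackWhiteSpan K := by
  obtain ⟨d, rfl⟩ : ∃ d' : FramedWord, d'.diagram = d := Quotient.exists_rep d
  rw [← wordClass_letters]
  exact wordClass_mem_blackWhiteSpan K _ _

end

/-! ### The projection onto the covariant elements -/

theorem ChordWord.order_diagram (c : ChordWord) : c.diagram.order = c.chords.card := rfl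

theorem FramedWord.order_diagram (d : FramedWord) : d.diagram.order = d.chords.card := rfl

theorem FramedWord.chords_sub (d : FramedWord) (I : Finset ℕ) :
    (d.sub I).chords = d.chords ∩ I := by
  ext x
  simp [ChordWord.chords, FramedWord.sub]

theorem FramedWord.sub_chords (d : FramedWord) : (d.sub d.chords).diagram = d.diagram := by
  refine FramedWord.diagram_eq ?_ fun _ _ => rfl
  change d.letters.filter (· ∈ d.letters.toFinset) = d.letters
  simp

theorem ChordWord.chords_eq_of_perm {c d : ChordWord} {l l' : List ℕ} (hc : c.letters = l)
    (hd : d.letters = l') (p : l.Perm l') : d.chords = c.chords := by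
  rw [ChordWord.chords, ChordWord.chords, hc, hd, List.toFinset_eq_of_perm _ _ p]

section

variable (K : Type*) [Field K]

/-! ### Linear maps out of the two spaces, and the grading of `𝒜`. -/

theorem linearMapM_ext {V : Type*} [AddCommGroup V] [Module K V] {g h : SpaceM K →ₗ[K] V}
    (H : ∀ d : FramedWord, g (d.diagram.toM K) = h (d.diagram.toM K)) : g = h := by
  refine Submodule.linearMap_qext _ (Finsupp.lhom_ext' fun d => LinearMap.ext_ring ?_)
  obtain ⟨d, rfl⟩ : ∃ d' : FramedWord, d'.diagram = d := Quotient.exists_rep d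
  exact H d

theorem linearMapA_ext {V : Type*} [AddCommGroup V] [Module K V] {g h : SpaceA K →ₗ[K] V}
    (H : ∀ c : ChordWord, g (c.diagram.toA K) = h (c.diagram.toA K)) : g = h := by
  refine Submodule.linearMap_qext _ (Finsupp.lhom_ext' fun d => LinearMap.ext_ring ?_)
  obtain ⟨d, rfl⟩ : ∃ d' : ChordWord, d'.diagram = d := Quotient.exists_rep d
  exact H d

/-- The four diagrams have equal order, so a relation is either kept whole or sent to zero term by
term. -/
theorem degreeA_fourTerm (k : ℕ) : fourTerm K ⊆ LinearMap.ker (Finsupp.linearCombination K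
    fun c : ChordDiagram => if c.order = k then c.toA K else 0) := by
  rintro v ⟨a, b, P, Q, w₁, w₂, w₃, w₄, h₁, h₂, h₃, h₄, rfl⟩
  obtain ⟨p₂, p₃, p₄⟩ := fourTerm_perm a b P Q
  have o₂ : w₂.diagram.order = w₁.diagram.order :=
    congrArg Finset.card (ChordWord.chords_eq_of_perm h₁ h₂ p₂)
  have o₃ : w₃.diagram.order = w₁.diagram.order :=
    congrArg Finset.card (ChordWord.chords_eq_of_perm h₁ h₃ p₃)
  have o₄ : w₄.diagram.order = w₁.diagram.order :=
    congrArg Finset.card (ChordWord.chords_eq_of_perm h₁ h₄ p₄)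
  simp only [SetLike.mem_coe, LinearMap.mem_ker, map_sub, Finsupp.linearCombination_single,
    one_smul, o₂, o₃, o₄]
  split_ifs
  · simp only [ChordDiagram.toA, ← Submodule.Quotient.mk_sub]
    rw [Submodule.Quotient.mk_eq_zero]
    exact Submodule.subset_span ⟨a, b, P, Q, _, _, _, _, h₁, h₂, h₃, h₄, rfl⟩
  · simp

/-- The projection of `𝒜` onto its homogeneous part of degree `k`. -/
noncomputable def degreeA (k : ℕ) : SpaceA K →ₗ[K] SpaceA K :=
  extendA K _ (degreeA_fourTerm K k)

theorem degreeA_toA (k : ℕ) (c : ChordDiagram) :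
    degreeA K k (c.toA K) = if c.order = k then c.toA K else 0 := extendA_toA K _ _ c

theorem degreeA_zero_oneA : degreeA K 0 (oneA K) = oneA K := by
  rw [oneA, degreeA_toA]
  exact if_pos rfl

/-! ### The coaction on diagrams. -/

theorem coactionM_diagram (d : FramedWord) : coactionM K (d.diagram.toM K) =
    ∑ I ∈ d.chords.powerset,
      prDiagram K (d.sub I).diagram ⊗ₜ[K] (d.sub (d.chords \ I)).diagram.toM K := by
  simp only [coactionM, LinearMap.comp_apply, coproductM, extendM_toM, coproductDiagram_diagram,
    map_sum, FramedWord.coterm, TensorProduct.map_tmul, prM, LinearMap.id_apply]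

theorem prDiagram_sub_empty (d : FramedWord) : prDiagram K (d.sub ∅).diagram = oneA K := by
  have h : (d.sub ∅).letters = [] := by simp [FramedWord.sub]
  rw [prDiagram_black K _ (by simp [h]), oneA]
  congr 1
  exact Quotient.sound ⟨1, by simp [h]⟩

/-- A nonempty subdiagram of a white diagram is not black, so only the decomposition with `I = ∅`
survives the projection. -/
theorem white_mem_covariantM (d : FramedWord) (hd : ∀ x ∈ d.letters, d.framing x = 1) :
    d.diagram.toM K ∈ covariantM K := by
  rw [covariantM, LinearMap.mem_eqLocus, coactionM_diagram,
    Finset.sum_eq_single_of_mem ∅ (by simp), prDiagram_sub_empty, Finset.sdiff_empty,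
    FramedWord.sub_chords]
  · rfl
  · intro I hI hne
    obtain ⟨x, hx⟩ := Finset.nonempty_iff_ne_empty.2 hne
    have hxd : x ∈ d.letters := List.mem_toFinset.1 (Finset.mem_powerset.1 hI hx)
    rw [prDiagram_of_not_black, TensorProduct.zero_tmul]
    intro h
    have h0 : d.framing x = 0 := h x (by simp [FramedWord.sub, hxd, hx])
    rw [hd x hxd] at h0
    exact absurd h0 (by decide)

/-- The projection of `𝒜` onto its part of positive degree. -/
noncomputable def positiveA : SpaceA K →ₗ[K] SpaceA K := LinearMap.id - degreeA K 0

theorem positiveA_oneA : positiveA K (oneA K) = 0 := by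
  rw [positiveA, LinearMap.sub_apply, degreeA_zero_oneA, LinearMap.id_apply, sub_self]

theorem positiveA_toA {c : ChordDiagram} (hc : c.order ≠ 0) :
    positiveA K (c.toA K) = c.toA K := by
  rw [positiveA, LinearMap.sub_apply, degreeA_toA, if_neg hc, sub_zero, LinearMap.id_apply]

/-- The operator `m ↦ ∑ m₀ · X m₁`, where the sum is over the terms `m₀ ⊗ m₁` of the coaction in
which `m₀` has positive degree. -/
noncomputable def positivePart (X : SpaceM K →ₗ[K] SpaceM K) : SpaceM K →ₗ[K] SpaceM K :=
  (TensorProduct.lift (mulM K)).comp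
    ((TensorProduct.map (positiveA K) X).comp (coactionM K))

theorem positivePart_diagram (X : SpaceM K →ₗ[K] SpaceM K) (d : FramedWord) :
    positivePart K X (d.diagram.toM K) = ∑ I ∈ d.chords.powerset,
      mulM K (positiveA K (prDiagram K (d.sub I).diagram))
        (X ((d.sub (d.chords \ I)).diagram.toM K)) := by
  simp only [positivePart, LinearMap.comp_apply, coactionM_diagram, map_sum,
    TensorProduct.map_tmul, TensorProduct.lift.tmul]

/-- The recursion behind `covariantProj` is well-founded: for `I = ∅` the first factor is the unit,
which `positiveA` kills, and for any other `I` the complement has fewer chords. -/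
theorem positivePart_congr {X Y : SpaceM K →ₗ[K] SpaceM K} (d : FramedWord)
    (h : ∀ e : FramedWord, e.chords.card < d.chords.card →
      X (e.diagram.toM K) = Y (e.diagram.toM K)) :
    positivePart K X (d.diagram.toM K) = positivePart K Y (d.diagram.toM K) := by
  rw [positivePart_diagram, positivePart_diagram]
  refine Finset.sum_congr rfl fun I hI => ?_
  by_cases hne : I = ∅
  · simp [hne, prDiagram_sub_empty, positiveA_oneA]
  · rw [h]
    rw [FramedWord.chords_sub]
    refine Finset.card_lt_card ?_
    rw [Finset.mem_powerset] at hI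
    rw [Finset.inter_eq_right.2 Finset.sdiff_subset]
    exact Finset.sdiff_ssubset hI (Finset.nonempty_iff_ne_empty.2 hne)

/-- Approximations of the projection onto the covariant elements: the `n`-th one is correct on
diagrams with at most `n` chords. -/
noncomputable def covariantApprox : ℕ → (SpaceM K →ₗ[K] SpaceM K)
  | 0 => LinearMap.id
  | n + 1 => LinearMap.id - positivePart K (covariantApprox n)

theorem covariantApprox_succ_apply (n : ℕ) (v : SpaceM K) :
    covariantApprox K (n + 1) v = v - positivePart K (covariantApprox K n) v := rfl

theorem covariantApprox_succ_eq (n : ℕ) (d : FramedWord) (h : d.chords.card ≤ n) :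
    covariantApprox K (n + 1) (d.diagram.toM K) = covariantApprox K n (d.diagram.toM K) := by
  induction n generalizing d with
  | zero =>
    have hd : d.chords = ∅ := Finset.card_eq_zero.1 (Nat.le_zero.1 h)
    rw [covariantApprox_succ_apply, positivePart_diagram, hd]
    simp [prDiagram_sub_empty, positiveA_oneA, covariantApprox]
  | succ n ih =>
    rw [covariantApprox_succ_apply, covariantApprox_succ_apply,
      positivePart_congr K d fun e he => ih e (by omega)]

theorem covariantApprox_eq_of_le {m n : ℕ} (hmn : m ≤ n) (d : FramedWord)
    (h : d.chords.card ≤ m) :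
    covariantApprox K n (d.diagram.toM K) = covariantApprox K m (d.diagram.toM K) := by
  induction n, hmn using Nat.le_induction with
  | base => rfl
  | succ n hn ih => rw [covariantApprox_succ_eq K n d (h.trans hn), ih]

/-- The index of the approximation depends on the diagram only through its order. This is constant
on a relation, so a single linear map on `ℳ` is applied to all four terms. -/
theorem covariantProj_fourTerm : framedFourTerm K ⊆ LinearMap.ker (Finsupp.linearCombination K
    fun d : FramedChordDiagram => covariantApprox K d.order (d.toM K)) := by
  rintro v ⟨a, b, P, Q, f, w₁, w₂, w₃, w₄, h₁, h₂, h₃, h₄, f₁, f₂, H⟩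
  obtain ⟨p₂, p₃, p₄⟩ := fourTerm_perm a b P Q
  have c₂ := ChordWord.chords_eq_of_perm h₁ h₂ p₂
  have c₃ := ChordWord.chords_eq_of_perm h₁ h₃ p₃
  have c₄ := ChordWord.chords_eq_of_perm h₁ h₄ p₄
  subst f₁
  rcases H with ⟨hfb, f₃, f₄, rfl⟩ | ⟨hfb, f₃, f₄, rfl⟩
  · simp only [SetLike.mem_coe, LinearMap.mem_ker, map_sub, Finsupp.linearCombination_single,
      one_smul, FramedWord.order_diagram, c₂, c₃, c₄]
    simp only [← map_sub]
    rw [toM_fourTerm_oriented K h₁ h₂ h₃ h₄ f₂ f₃ f₄ hfb, map_zero]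
  · simp only [SetLike.mem_coe, LinearMap.mem_ker, map_sub, Finsupp.linearCombination_single,
      one_smul, FramedWord.order_diagram, c₂, c₃, c₄]
    simp only [← map_sub]
    rw [toM_fourTerm_disorienting K h₁ h₂ h₃ h₄ f₂ f₃ f₄ hfb, map_zero]

/-- The projection of `ℳ` onto the covariant elements. -/
noncomputable def covariantProj : SpaceM K →ₗ[K] SpaceM K :=
  extendM K _ (covariantProj_fourTerm K)

theorem covariantProj_diagram_of_le {n : ℕ} (d : FramedWord) (h : d.chords.card ≤ n) :
    covariantProj K (d.diagram.toM K) = covariantApprox K n (d.diagram.toM K) := by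
  rw [covariantProj, extendM_toM, covariantApprox_eq_of_le K h d le_rfl]
  rfl

/-- The defining recursion of the projection. On a diagram with n chords, stage n + 1 is used: its
positive part applies stage n to smaller diagrams only, where that stage is already correct. -/
theorem covariantProj_eq : covariantProj K = LinearMap.id - positivePart K (covariantProj K) := by
  refine linearMapM_ext K fun d => ?_
  rw [covariantProj_diagram_of_le K d (Nat.le_succ _), covariantApprox_succ_apply,
    LinearMap.sub_apply, LinearMap.id_apply,
    positivePart_congr K d fun e he => (covariantProj_diagram_of_le K e he.le).symm]

theorem covariantProj_of_mem {v : SpaceM K} (hv : v ∈ covariantM K) :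
    covariantProj K v = v := by
  have h : coactionM K v = oneA K ⊗ₜ[K] v := hv
  rw [covariantProj_eq, LinearMap.sub_apply, positivePart, LinearMap.comp_apply,
    LinearMap.comp_apply, h]
  simp [positiveA_oneA]

/-! ### Products of black and white diagrams -/

/-- The word of `d` is the concatenation of the words of a black diagram `c` and a white
diagram `w`. -/
structure IsBlackWhite (d : FramedWord) (c : ChordWord) (w : FramedWord) : Prop where
  letters_eq : d.letters = c.letters ++ w.letters
  black : ∀ x ∈ c.letters, d.framing x = 0
  framing_eq : ∀ x ∈ w.letters, d.framing x = w.framing x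
  white : ∀ x ∈ w.letters, w.framing x = 1

namespace IsBlackWhite

variable {d w : FramedWord} {c : ChordWord}

theorem disjoint (h : IsBlackWhite d c w) : ∀ x ∈ c.letters, x ∉ w.letters := by
  intro x hx hx'
  have := h.black x hx
  rw [h.framing_eq x hx', h.white x hx'] at this
  exact absurd this (by decide)

theorem mulM_eq (h : IsBlackWhite d c w) :
    mulM K (c.diagram.toA K) (w.diagram.toM K) = d.diagram.toM K := by
  rw [mulM_eq_wordClass_append K c w d.framing h.disjoint h.black h.framing_eq, ← h.letters_eq,
    wordClass_letters]

theorem chords_eq (h : IsBlackWhite d c w) : d.chords = c.chords ∪ w.chords := by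
  rw [ChordWord.chords, h.letters_eq, List.toFinset_append]
  rfl

/-- Removing black chords leaves a product of a black diagram by the same white diagram. -/
theorem sub (h : IsBlackWhite d c w) {I : Finset ℕ} (hI : I ⊆ c.chords) :
    IsBlackWhite (d.sub (d.chords \ I))
    ⟨c.letters.filter (· ∉ I), c.double.filter _⟩ w where
  letters_eq := by
    have hc : ∀ x ∈ c.letters, decide (x ∈ d.chords \ I) = decide (x ∉ I) := fun x hx => by
      simp [ChordWord.chords, h.letters_eq, hx]
    have hw : ∀ x ∈ w.letters, decide (x ∈ d.chords \ I) = true := fun x hx => by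
      have : x ∉ I := fun hx' => h.disjoint x (List.mem_toFinset.1 (hI hx')) hx
      simp [ChordWord.chords, h.letters_eq, hx, this]
    change d.letters.filter _ = _
    rw [h.letters_eq, List.filter_append, List.filter_congr hc, List.filter_eq_self.2 hw]
  black x hx := h.black x (List.mem_filter.1 hx).1
  framing_eq := h.framing_eq
  white := h.white

theorem prDiagram_sub_chords (h : IsBlackWhite d c w) :
    prDiagram K (d.sub c.chords).diagram = c.diagram.toA K := by
  have e : (d.sub c.chords).letters = c.letters := by
    change d.letters.filter _ = _
    have hc : ∀ x ∈ c.letters, decide (x ∈ c.chords) = true := fun x hx => by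
      simp [ChordWord.chords, hx]
    have hw : ∀ x ∈ w.letters, ¬ decide (x ∈ c.chords) = true := fun x hx => by
      simpa [ChordWord.chords] using fun hx' => h.disjoint x hx' hx
    rw [h.letters_eq, List.filter_append, List.filter_eq_self.2 hc, List.filter_eq_nil_iff.2 hw,
      List.append_nil]
  rw [prDiagram_black K (d.sub c.chords) fun x hx => h.black x (by rwa [e] at hx)]
  congr 1
  exact Quotient.sound ⟨1, by simpa [e] using List.IsRotated.refl _⟩

theorem diagram_sub_sdiff (h : IsBlackWhite d c w) :
    (d.sub (d.chords \ c.chords)).diagram = w.diagram := by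
  have e : (d.sub (d.chords \ c.chords)).letters =
      c.letters.filter (· ∉ c.chords) ++ w.letters := (h.sub subset_rfl).letters_eq
  have hc : c.letters.filter (· ∉ c.chords) = [] := by
    simp [ChordWord.chords, List.filter_eq_nil_iff]
  rw [hc, List.nil_append] at e
  refine FramedWord.diagram_eq e fun x hx => ?_
  rw [e] at hx
  exact (h.framing_eq x hx).symm

/-- In a sum over the decompositions of the set of chords only the terms with a black first factor
contribute. -/
theorem sum_eq (h : IsBlackWhite d c w) {V : Type*} [AddCommGroup V] [Module K V]
    (β : SpaceA K →ₗ[K] SpaceM K →ₗ[K] V) (X : SpaceM K →ₗ[K] SpaceM K)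
    (H : ∀ I, I ⊆ c.chords → I ≠ c.chords → β (prDiagram K (d.sub I).diagram)
      (X ((d.sub (d.chords \ I)).diagram.toM K)) = 0) :
    ∑ I ∈ d.chords.powerset, β (prDiagram K (d.sub I).diagram)
        (X ((d.sub (d.chords \ I)).diagram.toM K)) =
      β (c.diagram.toA K) (X (w.diagram.toM K)) := by
  rw [Finset.sum_eq_single_of_mem c.chords, h.prDiagram_sub_chords K, h.diagram_sub_sdiff]
  · rw [Finset.mem_powerset, h.chords_eq]
    exact Finset.subset_union_left
  · intro I hI hne
    by_cases hIc : I ⊆ c.chords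
    · exact H I hIc hne
    · obtain ⟨x, hx, hxc⟩ := Finset.not_subset.1 hIc
      have hxd : x ∈ d.letters := List.mem_toFinset.1 (Finset.mem_powerset.1 hI hx)
      have hxw : x ∈ w.letters := by
        rw [h.letters_eq, List.mem_append] at hxd
        exact hxd.resolve_left fun h' => hxc (List.mem_toFinset.2 h')
      rw [prDiagram_of_not_black, map_zero, LinearMap.zero_apply]
      intro hb
      have h0 : d.framing x = 0 := hb x (by simp [FramedWord.sub, hxd, hx])
      rw [h.framing_eq x hxw, h.white x hxw] at h0
      exact absurd h0 (by decide)

end IsBlackWhite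

theorem filter_notMem_ne_nil {c : ChordWord} {I : Finset ℕ} (hI : I ⊆ c.chords)
    (hne : I ≠ c.chords) : c.letters.filter (· ∉ I) ≠ [] := by
  obtain ⟨x, hx, hxI⟩ := Finset.not_subset.1 fun h => hne (hI.antisymm h)
  exact List.ne_nil_of_mem (List.mem_filter.2 ⟨List.mem_toFinset.1 hx, by simpa using hxI⟩)

/-- In the recursion, the term of a nonempty proper subset of the chords of `c` vanishes by
induction, because some black chords remain; the term of `∅` is killed by `positiveA`. The whole of
`c` contributes `c · w = d`, which cancels the leading `d`. -/
theorem covariantProj_eq_zero {d w : FramedWord} {c : ChordWord} (h : IsBlackWhite d c w)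
    (hc : c.letters ≠ []) : covariantProj K (d.diagram.toM K) = 0 := by
  induction hn : d.chords.card using Nat.strong_induction_on generalizing d c with
  | _ n ih =>
    have hsum := h.sum_eq K ((mulM K).comp (positiveA K)) (covariantProj K) ?_
    · have hord : c.diagram.order ≠ 0 := by
        rw [ChordWord.order_diagram, Finset.card_ne_zero, ChordWord.chords]
        exact List.toFinset_nonempty_iff _ |>.2 hc
      rw [covariantProj_eq, LinearMap.sub_apply, positivePart_diagram]
      simp only [LinearMap.comp_apply] at hsum
      rw [hsum, covariantProj_of_mem K (white_mem_covariantM K w h.white), positiveA_toA K hord,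
        h.mulM_eq K, LinearMap.id_apply, sub_self]
    · intro I hI hne
      by_cases hI0 : I = ∅
      · simp [hI0, prDiagram_sub_empty, positiveA_oneA]
      · rw [ih _ ?_ (h.sub hI) (filter_notMem_ne_nil hI hne) rfl, map_zero]
        rw [← hn, FramedWord.chords_sub, Finset.inter_eq_right.2 Finset.sdiff_subset]
        refine Finset.card_lt_card (Finset.sdiff_ssubset ?_ (Finset.nonempty_iff_ne_empty.2 hI0))
        exact hI.trans (h.chords_eq ▸ Finset.subset_union_left)

/-- The inverse of the product map on the tensor product of `𝒜` with the covariant elements. -/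
noncomputable def splitM : SpaceM K →ₗ[K] SpaceA K ⊗[K] SpaceM K :=
  (TensorProduct.map LinearMap.id (covariantProj K)).comp (coactionM K)

/-- Unless all of `c` goes to the first factor, the second one still has black chords and the
projection kills it. -/
theorem splitM_of_isBlackWhite {d w : FramedWord} {c : ChordWord} (h : IsBlackWhite d c w) :
    splitM K (d.diagram.toM K) = c.diagram.toA K ⊗ₜ[K] w.diagram.toM K := by
  have hsum := h.sum_eq K (TensorProduct.mk K _ _) (covariantProj K) ?_
  · simp only [splitM, LinearMap.comp_apply, coactionM_diagram, map_sum, TensorProduct.map_tmul,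
      LinearMap.id_apply]
    simp only [TensorProduct.mk_apply] at hsum
    rw [hsum, covariantProj_of_mem K (white_mem_covariantM K w h.white)]
  · intro I hI hne
    rw [covariantProj_eq_zero K (h.sub hI) (filter_notMem_ne_nil hI hne), map_zero]

/-- The product of a chord diagram by a white diagram is represented by the concatenation of words
with different names of chords. -/
theorem exists_isBlackWhite (c : ChordWord) (w : FramedWord)
    (hw : ∀ x ∈ w.letters, w.framing x = 1) : ∃ (c' : ChordWord) (w' : FramedWord),
      IsBlackWhite (glue c w) c' w' ∧ c'.diagram = c.diagram ∧ w'.diagram = w.diagram := by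
  have il : Function.Injective (fun n : ℕ => chordSum (Sum.inl n)) :=
    chordSum.injective.comp Sum.inl_injective
  have ir : Function.Injective (fun n : ℕ => chordSum (Sum.inr n)) :=
    chordSum.injective.comp Sum.inr_injective
  refine ⟨⟨_, c.double.map il⟩, ⟨⟨_, w.double.map ir⟩, (glue c w).framing⟩,
    ⟨rfl, ?_, fun _ _ => rfl, ?_⟩, ?_, ?_⟩
  · intro x hx
    obtain ⟨n, -, rfl⟩ := List.mem_map.1 hx
    simp [glue]
  · intro x hx
    obtain ⟨n, hn, rfl⟩ := List.mem_map.1 hx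
    simpa [glue] using hw n hn
  · obtain ⟨ρ, hρ⟩ := exists_perm_eq_on_finset c.chords _ il.injOn
    refine (Quotient.sound ⟨ρ, ?_⟩ : c.diagram = _).symm
    rw [List.map_congr_left fun x hx => hρ x (List.mem_toFinset.2 hx)]
  · obtain ⟨ρ, hρ⟩ := exists_perm_eq_on_finset w.chords _ ir.injOn
    refine (Quotient.sound ⟨ρ, ?_, fun x hx => ?_⟩ : w.diagram = _).symm
    · rw [List.map_congr_left fun x hx => hρ x (List.mem_toFinset.2 hx)]
    · rw [hρ x (List.mem_toFinset.2 hx)]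
      simp [glue]

theorem splitM_mulM_diagram (c : ChordWord) (w : FramedWord)
    (hw : ∀ x ∈ w.letters, w.framing x = 1) :
    splitM K (mulM K (c.diagram.toA K) (w.diagram.toM K)) =
      c.diagram.toA K ⊗ₜ[K] w.diagram.toM K := by
  obtain ⟨c', w', h, hc, hw'⟩ := exists_isBlackWhite c w hw
  rw [mulM_diagram, splitM_of_isBlackWhite K h, hc, hw']

/-- The span of the white diagrams. -/
noncomputable def whiteSpan : Submodule K (SpaceM K) :=
  Submodule.span K {m | ∃ w : FramedChordDiagram, w.IsWhite ∧ w.toM K = m}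

/-! ### Covariant elements are combinations of white diagrams. -/

theorem blackWhiteSpan_eq_top : blackWhiteSpan K = ⊤ := by
  rw [← (blackWhiteSpan K).ker_mkQ, LinearMap.ker_eq_top]
  refine linearMapM_ext K fun d => ?_
  rw [Submodule.mkQ_apply, (Submodule.Quotient.mk_eq_zero _).2 (toM_mem_blackWhiteSpan K _),
    LinearMap.zero_apply]

/-- It suffices to test products of black by white diagrams: with an empty black factor the product
is white and fixed, otherwise it is sent to zero. -/
theorem covariantProj_mem_whiteSpan (v : SpaceM K) : covariantProj K v ∈ whiteSpan K := by
  have hv : v ∈ blackWhiteSpan K := blackWhiteSpan_eq_top K ▸ Submodule.mem_top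
  refine (Submodule.span_le.2 ?_ : blackWhiteSpan K ≤ (whiteSpan K).comap (covariantProj K)) hv
  rintro _ ⟨c, w, hw, rfl⟩
  obtain ⟨c, rfl⟩ : ∃ c' : ChordWord, c'.diagram = c := Quotient.exists_rep c
  obtain ⟨w, rfl⟩ : ∃ w' : FramedWord, w'.diagram = w := Quotient.exists_rep w
  obtain ⟨c', w', h, -, -⟩ := exists_isBlackWhite c w hw
  change covariantProj K _ ∈ whiteSpan K
  rw [mulM_diagram]
  by_cases hc : c'.letters = []
  · have hwhite : ∀ x ∈ (glue c w).letters, (glue c w).framing x = 1 := by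
      intro x hx
      rw [h.letters_eq, hc, List.nil_append] at hx
      rw [h.framing_eq x hx, h.white x hx]
    rw [covariantProj_of_mem K (white_mem_covariantM K _ hwhite)]
    exact Submodule.subset_span ⟨(glue c w).diagram, hwhite, rfl⟩
  · rw [covariantProj_eq_zero K h hc]
    exact zero_mem _

theorem covariantM_eq_whiteSpan : covariantM K = whiteSpan K := by
  refine le_antisymm (fun v hv => ?_) (Submodule.span_le.2 ?_)
  · rw [← covariantProj_of_mem K hv]
    exact covariantProj_mem_whiteSpan K v
  · rintro _ ⟨w, hw, rfl⟩
    obtain ⟨w, rfl⟩ : ∃ w' : FramedWord, w'.diagram = w := Quotient.exists_rep w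
    exact white_mem_covariantM K w hw

theorem splitM_mulM (c : SpaceA K) {v : SpaceM K} (hv : v ∈ covariantM K) :
    splitM K (mulM K c v) = c ⊗ₜ[K] v := by
  rw [covariantM_eq_whiteSpan] at hv
  induction hv using Submodule.span_induction with
  | mem v hv =>
    obtain ⟨w, hw, rfl⟩ := hv
    obtain ⟨w, rfl⟩ : ∃ w' : FramedWord, w'.diagram = w := Quotient.exists_rep w
    have : (splitM K).comp ((mulM K).flip (w.diagram.toM K)) =
        (TensorProduct.mk K _ _).flip (w.diagram.toM K) :=
      linearMapA_ext K fun c => splitM_mulM_diagram K c w hw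
    exact LinearMap.congr_fun this c
  | zero => simp
  | add u v _ _ hu hv => rw [map_add, map_add, hu, hv, TensorProduct.tmul_add]
  | smul r v _ hv => rw [map_smul, map_smul, hv, TensorProduct.tmul_smul]

/-! ### Products of functionals -/

/-- `splitM` recovers both factors of `c · v`, so φ ⊗ ψ can be pulled back along it. Which extension
of `ψ` to `ℳ` is taken does not matter, as only covariant second factors are tested. -/
theorem exists_isProductFunctional (φ : SpaceA K →ₗ[K] K) (ψ : covariantM K →ₗ[K] K) :
    ∃ t, IsProductFunctional K t φ ψ := by
  obtain ⟨ψ', hψ'⟩ := ψ.exists_extend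
  refine ⟨(TensorProduct.lift ((LinearMap.mul K K).compl₁₂ φ ψ')).comp (splitM K),
    fun c v => ?_⟩
  rw [LinearMap.comp_apply, splitM_mulM K c v.2, TensorProduct.lift.tmul]
  simp [← hψ']

theorem finiteDimensional_range_degreeA (k : ℕ) :
    FiniteDimensional K (LinearMap.range (degreeA K k)) := by
  have hfin := (ChordDiagram.finite_order_eq k).image fun c => c.toA K
  have hF := FiniteDimensional.span_of_finite K hfin
  set S := Submodule.span K ((fun c : ChordDiagram => c.toA K) '' {c | c.order = k})
  refine Submodule.finiteDimensional_of_le (S₂ := S) ?_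
  suffices h : S.mkQ.comp (degreeA K k) = 0 by
    rintro _ ⟨x, rfl⟩
    rw [← Submodule.Quotient.mk_eq_zero]
    exact LinearMap.congr_fun h x
  refine linearMapA_ext K fun c => ?_
  rw [LinearMap.comp_apply, degreeA_toA, LinearMap.zero_apply, Submodule.mkQ_apply,
    Submodule.Quotient.mk_eq_zero]
  split_ifs with h
  · exact Submodule.subset_span ⟨_, h, rfl⟩
  · exact zero_mem _

theorem map_mulM_degreeA_eq_zero {n : ℕ} {s : SpaceM K →ₗ[K] K} (hs : IsHomogeneousM K n s)
    {k : ℕ} (x : SpaceA K) (w : FramedWord) (h : k + w.diagram.order ≠ n) :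
    s (mulM K (degreeA K k x) (w.diagram.toM K)) = 0 := by
  have : (s.comp ((mulM K).flip (w.diagram.toM K))).comp (degreeA K k) = 0 := by
    refine linearMapA_ext K fun c => ?_
    rw [LinearMap.comp_apply, degreeA_toA, LinearMap.zero_apply]
    split_ifs with hc
    · rw [LinearMap.comp_apply, LinearMap.flip_apply, mulM_diagram]
      exact hs _ (by rw [glue_order, hc]; exact h)
    · rw [map_zero]
  exact LinearMap.congr_fun this x

theorem sum_map_mulM_degreeA {n : ℕ} {s : SpaceM K →ₗ[K] K} (hs : IsHomogeneousM K n s)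
    (c : ChordWord) (w : FramedWord) :
    ∑ k ∈ Finset.range (n + 1), s (mulM K (degreeA K k (c.diagram.toA K)) (w.diagram.toM K)) =
      s (mulM K (c.diagram.toA K) (w.diagram.toM K)) := by
  rw [Finset.sum_eq_single c.diagram.order, degreeA_toA, if_pos rfl]
  · intro k _ hk
    rw [degreeA_toA, if_neg hk.symm]
    simp
  -- If `c` has more than `n` chords, its degree is outside the range of summation, but then `s`
  -- vanishes on the product.
  · intro h
    refine map_mulM_degreeA_eq_zero K hs _ w ?_
    rw [Finset.mem_range] at h
    omega

/-- Expanding the black factor of `c · w` in bases of the homogeneous parts of `𝒜` separates the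
variables in `s (c · w)`. -/
theorem homogeneous_mem_span_products (n : ℕ) (s : SpaceM K →ₗ[K] K)
    (hs : IsHomogeneousM K n s) :
    s ∈ Submodule.span K {t | ∃ (k l : ℕ) (φ : SpaceA K →ₗ[K] K) (ψ : covariantM K →ₗ[K] K),
      k + l = n ∧ IsHomogeneousA K k φ ∧ IsHomogeneousCo K l ψ ∧
        IsProductFunctional K t φ ψ} := by
  have hfd := finiteDimensional_range_degreeA K
  let b := fun k => Module.finBasis K (LinearMap.range (degreeA K k))
  -- `φ k i` reads off the i-th coordinate of the degree-k part, and `ψ k i` is `s` of the product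
  -- by the i-th basis vector.
  let φ := fun k i => ((b k).coord i).comp (degreeA K k).rangeRestrict
  let ψ := fun k i => (s.comp (mulM K (b k i : SpaceA K))).comp (covariantM K).subtype
  choose t ht using fun k i => exists_isProductFunctional K (φ k i) (ψ k i)
  have hst : s = ∑ k ∈ Finset.range (n + 1), ∑ i, t k i := by
    refine LinearMap.ext_on (blackWhiteSpan_eq_top K) ?_
    rintro _ ⟨c, w, hw, rfl⟩
    obtain ⟨c, rfl⟩ : ∃ c' : ChordWord, c'.diagram = c := Quotient.exists_rep c
    obtain ⟨w, rfl⟩ : ∃ w' : FramedWord, w'.diagram = w := Quotient.exists_rep w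
    have hco := white_mem_covariantM K w hw
    rw [← sum_map_mulM_degreeA K hs, LinearMap.sum_apply]
    refine Finset.sum_congr rfl fun k _ => ?_
    rw [LinearMap.sum_apply]
    have hl : degreeA K k (c.diagram.toA K) =
        ∑ i, φ k i (c.diagram.toA K) • (b k i : SpaceA K) := by
      have hb := congrArg Subtype.val
        ((b k).sum_repr ((degreeA K k).rangeRestrict (c.diagram.toA K)))
      rw [Submodule.coe_sum] at hb
      exact hb.symm
    rw [hl, map_sum, LinearMap.sum_apply, map_sum]
    refine Finset.sum_congr rfl fun i _ => ?_
    rw [ht k i (c.diagram.toA K) ⟨_, hco⟩, map_smul, LinearMap.smul_apply, map_smul]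
    rfl
  rw [hst]
  refine sum_mem fun k hk => sum_mem fun i _ => Submodule.subset_span
    ⟨k, n - k, φ k i, ψ k i, ?_, ?_, ?_, ht k i⟩
  · rw [Finset.mem_range] at hk
    omega
  · intro c hc
    have : (degreeA K k).rangeRestrict (c.toA K) = 0 := by
      ext
      simp [degreeA_toA, hc]
    simp [φ, this]
  · intro w hw hord hco
    obtain ⟨w, rfl⟩ : ∃ w' : FramedWord, w'.diagram = w := Quotient.exists_rep w
    -- The basis vector is the degree-k part of some `x`; its product with `w` has degree `k +
    -- w.order`, which differs from `n`.
    obtain ⟨x, hx⟩ := (b k i).2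
    change s (mulM K (b k i : SpaceA K) (w.diagram.toM K)) = 0
    rw [← hx]
    refine map_mulM_degreeA_eq_zero K hs x w ?_
    omega

end

theorem mainTheorem1 (K : Type*) [Field K] [CharZero K] :
    covariantM K =
        Submodule.span K {m | ∃ w : FramedChordDiagram, w.IsWhite ∧ w.toM K = m} ∧
      (∀ d : FramedChordDiagram, d.toM K ∈
        Submodule.span K {m | ∃ (c : ChordDiagram) (w : FramedChordDiagram),
          w.IsWhite ∧ mulM K (c.toA K) (w.toM K) = m}) ∧
      (∀ (n : ℕ) (s : SpaceM K →ₗ[K] K), IsHomogeneousM K n s →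
        s ∈ Submodule.span K {t | ∃ (k l : ℕ) (φ : SpaceA K →ₗ[K] K) (ψ : covariantM K →ₗ[K] K),
          k + l = n ∧ IsHomogeneousA K k φ ∧ IsHomogeneousCo K l ψ ∧
            IsProductFunctional K t φ ψ}) :=
  ⟨covariantM_eq_whiteSpan K, toM_mem_blackWhiteSpan K, homogeneous_mem_span_products K⟩
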